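/- **Setting.** Consider a chain of $n$ sites, each with a $d$-dimensional Hilbert space ($2\le d<\infty$), and Hermitian interaction terms $h_Z$ supported on $Z\subset\{1,\dots,n\}$ with $h_Z=0$ for $|Z|>k$. Assume the power-law decay $\max_i\sum_{Z\ni i,\ \mathrm{diam}(Z)=r}\|h_Z\|\le J r^{-\alpha}$ for all integers $r\ge1$, with $\alpha>1$, and $\max_i\|h_{\{i\}}\|\le B$; put $g:=B+\frac{\alpha J}{\alpha-1}$. For $X,Y\subset\Lambda_0$ let $V_{X,Y}(\Lambda_0)$ be the sum of all $h_Z$ with $Z\subset\Lambda_0$, $Z\cap X\ne\emptyset$, $Z\cap Y\ne\emptyset$. Assume that there are constants $\bar\alpha>0$ and $g_0\ge g$ such that $\|V_{X,Y}(\Lambda_0)\|\le g_0\,\mathrm{dist}(X,Y)^{-\bar\alpha}$ for all disjoint nonempty intervals $X,Y$ and all $\Lambda_0\supset X\sqcup Y$. (In energy units with $g=1$ the condition on $g_0$ is $g_0\ge1$.) Let $q\ge2$ be even and $l\ge 1$, and cut the chain into consecutive blocks $B_0,B_1,\dots,B_q,B_{q+1}$ with $|B_s|=l$ for $1\le s\le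 q$, the edge blocks $B_0$ and $B_{q+1}$ containing the remaining sites on the left and on the right. Let $h_s$ be the sum of the terms $h_Z$, $\emptyset\ne Z\subset B_s$, let $h_{s,s+1}:=V_{B_s,B_{s+1}}(B_s\sqcup B_{s+1})$, and $$H_{\rm t}=\sum_{s=0}^{q+1}h_s+\sum_{s=0}^{q}h_{s,s+1}.$$ For $\tau\in\mathbb R$ let $\tilde h_s$ be obtained from $h_s$ by replacing every eigenvalue $E\ge E_{s,0}+\tau$ by $E_{s,0}+\tau$ and keeping the eigenvectors, where $E_{s,0}$ is the smallest eigenvalue of $h_s$, and put $$\tilde H_{\rm t}=\sum_{s=0}^{q+1}\tilde h_s+\sum_{s=0}^{q}h_{s,s+1}.$$ Let $\Delta_{\rm t}$ and $\tilde\Delta_{\rm t}$ be the spectral gaps of $H_{\rm t}$ and $\tilde H_{\rm t}$, that is, the second-smallest eigenvalue (counted with multiplicity) minus the smallest, and assume $\Delta_{\rm t}>0$. **Theorem 5.** Let $$\lambda:=\frac{1}{12gk^2+4g_0},\qquad \lambda':=\min\Bigl(\frac1{112g_0},\frac1{12gk^2}\Bigr),$$ and let $$\tau\ \ge\ \max\Bigl[\,8g_0+\frac1{\lambda'}\log\Bigl(\frac{88g_0(q+1)(q+2)}{\Delta_{\rm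 t}}\Bigr),\ \ 4g_0+\frac1\lambda\log\Bigl(\frac{432(q+2)}{\lambda\Delta_{\rm t}}\Bigr)\Bigr].$$ Then $$\tilde\Delta_{\rm t}\ \ge\ \tfrac12\Delta_{\rm t},$$ and, for all normalized ground states $|0_{\rm t}\rangle$ of $H_{\rm t}$ and $|\tilde 0_{\rm t}\rangle$ of $\tilde H_{\rm t}$ whose phases are chosen so that $\langle 0_{\rm t}|\tilde 0_{\rm t}\rangle$ is real and nonnegative, $$\bigl\|\,|\tilde 0_{\rm t}\rangle-|0_{\rm t}\rangle\bigr\|\ \le\ \frac{54(q+2)}{\lambda\Delta_{\rm t}}\,e^{-\lambda(\tau-4g_0)}.$$ -/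

import Mathlib

noncomputable section

namespace LongRange

open scoped Matrix.Norms.L2Operator

/-! ### Spectral notions for Hermitian matrices -/

section Spectral

variable {ι : Type*} [Fintype ι] [DecidableEq ι]

/-- `energy A j` is the `j`-th eigenvalue `E_j` (`j = 0, 1, …`) of the Hermitian matrix `A`, the
eigenvalues being listed in *ascending* order and repeated according to multiplicity
(`Matrix.IsHermitian.eigenvalues₀` lists them in descending order). -/
def energy (A : Matrix ι ι ℂ) (j : ℕ) : ℝ :=
  if h : A.IsHermitian ∧ j < Fintype.card ι then
    h.1.eigenvalues₀ (Fin.rev ⟨j, h.2⟩)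
  else 0

/-- The spectral gap `E_1 - E_0`; it is zero when the ground state is degenerate. -/
def spectralGap (A : Matrix ι ι ℂ) : ℝ := energy A 1 - energy A 0

/-- `ψ` is a normalized ground state of `A`. -/
def IsGroundState (A : Matrix ι ι ℂ) (ψ : EuclideanSpace ℂ ι) : Prop :=
  ‖ψ‖ = 1 ∧ Matrix.toEuclideanLin A ψ = (energy A 0 : ℂ) • ψ

/-- Energy cut-off at height `c`: every eigenvalue `E` of the Hermitian matrix `A` with `E ≥ c` is
replaced by `c`, the other eigenvalues and all eigenvectors being kept. -/
def cutoff (c : ℝ) (A : Matrix ι ι ℂ) : Matrix ι ι ℂ := cfc (fun E : ℝ => min E c) A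

end Spectral

/-! ### Spin chains -/

/-- Operators on the Hilbert space `(ℂ^d)^{⊗ n}` of `n` sites, as matrices in the product basis.
The norm on them is the operator norm. -/
abbrev Op (n d : ℕ) : Type := Matrix (Fin n → Fin d) (Fin n → Fin d) ℂ

/-- `A` is supported on the set `Z` of sites: `A = a ⊗ 1` with `a` acting on the sites in `Z`. -/
def SupportedOn {n d : ℕ} (Z : Finset (Fin n)) (A : Op n d) : Prop :=
  ∃ a : Matrix (Z → Fin d) (Z → Fin d) ℂ, ∀ x y : Fin n → Fin d,
    ((∀ i, i ∉ Z → x i = y i) → A x y = a (fun i => x i) (fun i => y i)) ∧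
    ((∃ i, i ∉ Z ∧ x i ≠ y i) → A x y = 0)

/-- The interaction terms `h_Z` of a Hamiltonian `H = ∑_{|Z| ≤ k} h_Z` on `n` sites. -/
structure Interaction (n d k : ℕ) where
  /-- the term `h_Z` -/
  term : Finset (Fin n) → Op n d
  isHermitian : ∀ Z, (term Z).IsHermitian
  supportedOn : ∀ Z, SupportedOn Z (term Z)
  eq_zero_of_card : ∀ Z, k < Z.card → term Z = 0

/-- `diam Z = max_{i, j ∈ Z} |i - j|`. -/
def diam {n : ℕ} (Z : Finset (Fin n)) : ℕ :=
  Z.sup fun i => Z.sup fun j => Nat.dist i j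

/-- `dist(X, Y) = min_{i ∈ X, j ∈ Y} |i - j|` (for nonempty `X` and `Y`). -/
def siteDist {n : ℕ} (X Y : Finset (Fin n)) : ℕ :=
  sInf {r : ℕ | ∃ i ∈ X, ∃ j ∈ Y, r = Nat.dist i j}

/-- `X` consists of consecutive sites. -/
def IsInterval {n : ℕ} (X : Finset (Fin n)) : Prop :=
  ∀ i ∈ X, ∀ j ∈ X, ∀ m, i ≤ m → m ≤ j → m ∈ X

/-- The chain of `n` sites is cut into the consecutive blocks `B_0, B_1, …, B_q, B_{q+1}`: the left
edge block `B_0` consists of the first `a` sites, each of `B_1, …, B_q` has `l` sites, and the right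
edge block `B_{q+1}` consists of all the remaining sites. -/
def block (n q l a s : ℕ) : Finset (Fin n) :=
  Finset.univ.filter fun i : Fin n =>
    if s = 0 then (i : ℕ) < a
    else if s ≤ q then a + (s - 1) * l ≤ (i : ℕ) ∧ (i : ℕ) < a + s * l
    else a + q * l ≤ (i : ℕ)

namespace Interaction

variable {n d k : ℕ} (Φ : Interaction n d k)

/-- Power-law decay: `max_i ∑_{Z ∋ i, diam Z = r} ‖h_Z‖ ≤ J / r^α` for all `r ≥ 1`. -/
def PowerLaw (J α : ℝ) : Prop :=
  ∀ (i : Fin n) (r : ℕ), 1 ≤ r →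
    ∑ Z : Finset (Fin n) with i ∈ Z ∧ diam Z = r, ‖Φ.term Z‖ ≤ J / (r : ℝ) ^ α

/-- The one-site terms are bounded: `max_i ‖h_{i}‖ ≤ B`. -/
def OneSiteBound (B : ℝ) : Prop := ∀ i : Fin n, ‖Φ.term {i}‖ ≤ B

/-- `V_{X,Y}(Λ₀)`: the sum of all `h_Z` with `Z ⊆ Λ₀` that meet both `X` and `Y`. -/
def V (X Y Λ₀ : Finset (Fin n)) : Op n d :=
  ∑ Z : Finset (Fin n) with Z ⊆ Λ₀ ∧ (Z ∩ X).Nonempty ∧ (Z ∩ Y).Nonempty, Φ.term Z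

/-- Algebraic decay of the interaction between two disjoint intervals `X` and `Y`:
`‖V_{X,Y}(Λ₀)‖ ≤ g₀ r^{-ᾱ}` with `r = dist(X, Y)`, for all `Λ₀ ⊇ X ⊔ Y`. -/
def BlockDecay (g₀ αbar : ℝ) : Prop :=
  ∀ X Y Λ₀ : Finset (Fin n), X.Nonempty → Y.Nonempty → IsInterval X → IsInterval Y →
    Disjoint X Y → X ∪ Y ⊆ Λ₀ → ‖Φ.V X Y Λ₀‖ ≤ g₀ * (siteDist X Y : ℝ) ^ (-αbar)

/-- The block Hamiltonian `h_s`: all the terms supported in `B_s`. -/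
def blockHam (q l a s : ℕ) : Op n d :=
  ∑ Z : Finset (Fin n) with Z.Nonempty ∧ Z ⊆ block n q l a s, Φ.term Z

/-- The interaction `h_{s,s+1} = V_{B_s,B_{s+1}}(B_s ⊔ B_{s+1})` of two adjacent blocks. -/
def bondHam (q l a s : ℕ) : Op n d :=
  Φ.V (block n q l a s) (block n q l a (s + 1)) (block n q l a s ∪ block n q l a (s + 1))

/-- The truncated Hamiltonian `H_t = ∑_{s=0}^{q+1} h_s + ∑_{s=0}^{q} h_{s,s+1}`. -/
def truncHam (q l a : ℕ) : Op n d :=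
  ∑ s ∈ Finset.range (q + 2), Φ.blockHam q l a s +
    ∑ s ∈ Finset.range (q + 1), Φ.bondHam q l a s

/-- The block Hamiltonian with energy cut-off, `h̃_s`: the spectrum of `h_s` is capped at
`τ_s = E_{s,0} + τ`. -/
def cutBlockHam (q l a : ℕ) (τ : ℝ) (s : ℕ) : Op n d :=
  cutoff (energy (Φ.blockHam q l a s) 0 + τ) (Φ.blockHam q l a s)

/-- The effective Hamiltonian `H̃_t = ∑_{s=0}^{q+1} h̃_s + ∑_{s=0}^{q} h_{s,s+1}`. -/
def effHam (q l a : ℕ) (τ : ℝ) : Op n d :=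
  ∑ s ∈ Finset.range (q + 2), Φ.cutBlockHam q l a τ s +
    ∑ s ∈ Finset.range (q + 1), Φ.bondHam q l a s

end Interaction

/-- The bound `g = B + α J / (α - 1)` on the one-site energy `∑_{Z ∋ i} ‖h_Z‖`. -/
def siteEnergy (J α B : ℝ) : ℝ := B + α * J / (α - 1)

/-- `λ = 1 / (12 g k² + 4 g₀)`. -/
def rate (g g₀ : ℝ) (k : ℕ) : ℝ := 1 / (12 * g * (k : ℝ) ^ 2 + 4 * g₀)

/-- `λ' = min (1 / (112 g₀), 1 / (12 g k²))`. -/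
def rate' (g g₀ : ℝ) (k : ℕ) : ℝ := min (1 / (112 * g₀)) (1 / (12 * g * (k : ℝ) ^ 2))

end LongRange

end

/-!
The two Hamiltonians differ by `D = ∑_s (h_s - h̃_s) ≥ 0`. If every eigenvector `φ` of `H̃` of low
energy satisfies `‖D φ‖ ≪ Δ`, then it is an approximate eigenvector of `H`, hence close to the ground
state of `H` because of the gap `Δ`. There is room for only one such `φ`, so `H̃` has a gap of at
least `Δ / 2`, and the two ground states are close
(`gap_and_ground_state_of_low_energy`). Everything rests on a bound for `‖(h_s - h̃_s) φ‖`.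

*Exponential tails.* Let `V` be the interaction of the block `B_s` with its two neighbours, and `R`
the part of `H̃` away from `B_s`. Conjugating `(h̃_s + R + V) φ = E φ` with `e^{λ h_s}`, which commutes
with everything but `V`, shows that the state `e^{λ h_s} φ` has an average energy `h̃_s` of at most
`E - min R + ‖e^{λ h_s} V e^{-λ h_s}‖`. This is a bound on an exponential moment of the energy
distribution of `h_s` in the state `φ`, and gives `‖(h_s - h̃_s) φ‖ ≤ e^{-λ z} / λ`, where `z` is the
distance of the cut-off from that energy (`agmon_estimate`, `norm_sub_cutoff_act_le`). A common
ground vector of `h_s` and `R` (`exists_common_ground`) shows that the ground state energy of `H̃` is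
at most `min h_s + min R + ‖V‖`.

*Imaginary time evolution.* For long-range interactions the sum of the norms of the terms in `V` is
not under control, only `‖V‖ ≤ 2 g₀` is. So the nested commutators have to be estimated through the
norm of `V` itself. For a `k`-body Hamiltonian `H` with one-site energy `g` and any `q`-body operator
`Γ`, `‖[H, Γ]‖ ≤ (8/3) g k q ‖Γ‖` (`norm_lie_le`). To see this, `H` is written as a superposition of
sums of commuting terms on pairwise disjoint sets (`exists_matchings`); for such a sum `A` of
contractions, `e^{itA} Γ e^{-itA}` has frequencies in `[-2q, 2q]` only, and Bernstein's inequality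
applies (`norm_lie_matching_le`). It follows that `‖e^{λ h_s} V e^{-λ h_s}‖ ≤ 2 ‖V‖` for
`λ ≤ 1 / (12 g k²)`.

*The gap.* Since `H` without the terms acting on one given site has degenerate levels, `Δ ≤ 6 g`
(`spectralGap_le`, `spectralGap_truncHam_le`). Therefore `λ Δ` is bounded, and the lower bound on `τ`
that involves `λ` is sufficient for both conclusions.
-/

noncomputable section

namespace LongRange

open scoped Matrix.Norms.L2Operator

/-- The vector that results from applying a matrix to a vector of the Hilbert space. -/
local notation:73 A:74 " ▹ " φ:73 => Matrix.toEuclideanLin A φ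

/-! ### Matrices acting on vectors, eigenvalues and functional calculus -/

section Spectral

variable {ι : Type*} [Fintype ι] [DecidableEq ι]

lemma mul_act (A B : Matrix ι ι ℂ) (φ : EuclideanSpace ℂ ι) : (A * B) ▹ φ = A ▹ (B ▹ φ) := by
  simp [Matrix.toLpLin_apply, Matrix.mulVec_mulVec]

lemma add_act (A B : Matrix ι ι ℂ) (φ : EuclideanSpace ℂ ι) : (A + B) ▹ φ = A ▹ φ + B ▹ φ := by
  simp

lemma sub_act (A B : Matrix ι ι ℂ) (φ : EuclideanSpace ℂ ι) : (A - B) ▹ φ = A ▹ φ - B ▹ φ := by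
  simp

lemma sum_act {κ : Type*} (s : Finset κ) (A : κ → Matrix ι ι ℂ) (φ : EuclideanSpace ℂ ι) :
    (∑ j ∈ s, A j) ▹ φ = ∑ j ∈ s, A j ▹ φ := by
  simp

lemma norm_act_le (A : Matrix ι ι ℂ) (φ : EuclideanSpace ℂ ι) : ‖A ▹ φ‖ ≤ ‖A‖ * ‖φ‖ :=
  Matrix.l2_opNorm_mulVec A φ

lemma inner_act {A : Matrix ι ι ℂ} (hA : A.IsHermitian) (φ ψ : EuclideanSpace ℂ ι) :
    inner ℂ (A ▹ φ) ψ = inner ℂ φ (A ▹ ψ) :=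
  Matrix.isSymmetric_toEuclideanLin_iff.mpr hA φ ψ

lemma re_inner_act_le (A : Matrix ι ι ℂ) (φ : EuclideanSpace ℂ ι) :
    |(inner ℂ φ (A ▹ φ)).re| ≤ ‖A‖ * ‖φ‖ ^ 2 := by
  calc |(inner ℂ φ (A ▹ φ)).re| ≤ ‖inner ℂ φ (A ▹ φ)‖ := Complex.abs_re_le_norm _
    _ ≤ ‖φ‖ * ‖A ▹ φ‖ := norm_inner_le_norm _ _
    _ ≤ ‖φ‖ * (‖A‖ * ‖φ‖) := by gcongr; exact norm_act_le A φ
    _ = ‖A‖ * ‖φ‖ ^ 2 := by ring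

lemma act_eigenvectorBasis {A : Matrix ι ι ℂ} (hA : A.IsHermitian) (i : ι) :
    A ▹ hA.eigenvectorBasis i = (hA.eigenvalues i : ℂ) • hA.eigenvectorBasis i := by
  have := hA.mulVec_eigenvectorBasis i
  ext j
  simpa [Matrix.toLpLin_apply] using congrFun this j

lemma cfc_act_eigenvectorBasis {A : Matrix ι ι ℂ} (hA : A.IsHermitian) (f : ℝ → ℝ) (i : ι) :
    cfc f A ▹ hA.eigenvectorBasis i = (f (hA.eigenvalues i) : ℂ) • hA.eigenvectorBasis i := by
  have h : Matrix.mulVec (cfc f A) ⇑(hA.eigenvectorBasis i) =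
      (f (hA.eigenvalues i) : ℂ) • ⇑(hA.eigenvectorBasis i) := by
    rw [hA.cfc_eq, Matrix.IsHermitian.cfc, Unitary.conjStarAlgAut_apply, ← Matrix.mulVec_mulVec,
      ← Matrix.mulVec_mulVec, hA.star_eigenvectorUnitary_mulVec, Matrix.diagonal_mulVec_single]
    have : (Pi.single i (((RCLike.ofReal ∘ f ∘ hA.eigenvalues) i : ℂ) * 1) : ι → ℂ)
        = (f (hA.eigenvalues i) : ℂ) • Pi.single i 1 := by
      rw [← Pi.single_smul]; simp
    rw [this, Matrix.mulVec_smul, hA.eigenvectorUnitary_mulVec]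
  ext j
  simpa [Matrix.toLpLin_apply] using congrFun h j

lemma isHermitian_cfc {A : Matrix ι ι ℂ} (f : ℝ → ℝ) : (cfc f A).IsHermitian :=
  cfc_predicate f A

lemma inner_basis_act {A : Matrix ι ι ℂ} (hA : A.IsHermitian) (i : ι) (φ : EuclideanSpace ℂ ι) :
    inner ℂ (hA.eigenvectorBasis i) (A ▹ φ)
      = (hA.eigenvalues i : ℂ) * inner ℂ (hA.eigenvectorBasis i) φ := by
  rw [← inner_act hA, act_eigenvectorBasis, inner_smul_left]; simp

lemma inner_basis_cfc {A : Matrix ι ι ℂ} (hA : A.IsHermitian) (f : ℝ → ℝ) (i : ι)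
    (φ : EuclideanSpace ℂ ι) :
    inner ℂ (hA.eigenvectorBasis i) (cfc f A ▹ φ)
      = (f (hA.eigenvalues i) : ℂ) * inner ℂ (hA.eigenvectorBasis i) φ := by
  rw [← inner_act (isHermitian_cfc f), cfc_act_eigenvectorBasis, inner_smul_left]; simp

lemma cfc_act_of_eigen {A : Matrix ι ι ℂ} (hA : A.IsHermitian) (f : ℝ → ℝ) {E : ℝ}
    {φ : EuclideanSpace ℂ ι} (h : A ▹ φ = (E : ℂ) • φ) : cfc f A ▹ φ = (f E : ℂ) • φ := by
  refine hA.eigenvectorBasis.repr.injective (PiLp.ext fun i => ?_)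
  rw [OrthonormalBasis.repr_apply_apply, OrthonormalBasis.repr_apply_apply, inner_basis_cfc,
    inner_smul_right]
  have h1 := inner_basis_act hA i φ
  rw [h, inner_smul_right] at h1
  by_cases h0 : inner ℂ (hA.eigenvectorBasis i) φ = 0
  · simp [h0]
  · have := mul_right_cancel₀ h0 h1
    rw [Complex.ofReal_inj.mp this]

lemma re_inner_cfc {A : Matrix ι ι ℂ} (hA : A.IsHermitian) (f : ℝ → ℝ)
    (φ : EuclideanSpace ℂ ι) :
    (inner ℂ φ (cfc f A ▹ φ)).re
      = ∑ i, f (hA.eigenvalues i) * ‖inner ℂ (hA.eigenvectorBasis i) φ‖ ^ 2 := by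
  rw [← hA.eigenvectorBasis.sum_inner_mul_inner, Complex.re_sum]
  refine Finset.sum_congr rfl fun i _ => ?_
  rw [inner_basis_cfc, mul_left_comm, ← inner_conj_symm, Complex.conj_mul',
    ← Complex.ofReal_pow, ← Complex.ofReal_mul, Complex.ofReal_re]

lemma re_inner_act_eq_sum {A : Matrix ι ι ℂ} (hA : A.IsHermitian) (φ : EuclideanSpace ℂ ι) :
    (inner ℂ φ (A ▹ φ)).re
      = ∑ i, hA.eigenvalues i * ‖inner ℂ (hA.eigenvectorBasis i) φ‖ ^ 2 := by
  have := re_inner_cfc hA id φ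
  rwa [cfc_id ℝ A hA.isSelfAdjoint] at this

lemma energy_zero_le_eigenvalues {A : Matrix ι ι ℂ} (hA : A.IsHermitian) (i : ι) :
    energy A 0 ≤ hA.eigenvalues i := by
  have hc : 0 < Fintype.card ι := Fintype.card_pos_iff.mpr ⟨i⟩
  rw [energy, dif_pos ⟨hA, hc⟩]
  refine hA.eigenvalues₀_antitone ?_
  rw [Fin.le_iff_val_le_val, Fin.val_rev]
  have := ((Fintype.equivOfCardEq (Fintype.card_fin (Fintype.card ι))).symm i).2
  simp only; omega

lemma exists_eigenvalues_eq_energy_zero [Nonempty ι] {A : Matrix ι ι ℂ} (hA : A.IsHermitian) :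
    ∃ i, hA.eigenvalues i = energy A 0 := by
  have hc : 0 < Fintype.card ι := Fintype.card_pos
  refine ⟨Fintype.equivOfCardEq (Fintype.card_fin _) (Fin.rev ⟨0, hc⟩), ?_⟩
  rw [energy, dif_pos ⟨hA, hc⟩, Matrix.IsHermitian.eigenvalues, Equiv.symm_apply_apply]

/-- The two lowest levels `E_0`, `E_1` belong to two different vectors of the eigenbasis, and all
the eigenvalues but the first are at least `E_1`. -/
lemma exists_two_lowest {A : Matrix ι ι ℂ} (hA : A.IsHermitian) (hc : 1 < Fintype.card ι) :
    ∃ i₀ i₁ : ι, i₀ ≠ i₁ ∧ hA.eigenvalues i₀ = energy A 0 ∧ hA.eigenvalues i₁ = energy A 1 ∧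
      ∀ i, i ≠ i₀ → energy A 1 ≤ hA.eigenvalues i := by
  have hc0 : 0 < Fintype.card ι := by omega
  set e : Fin (Fintype.card ι) ≃ ι := Fintype.equivOfCardEq (Fintype.card_fin _) with he
  refine ⟨e (Fin.rev ⟨0, hc0⟩), e (Fin.rev ⟨1, hc⟩), ?_, ?_, ?_, fun i hi => ?_⟩
  · rw [Ne, e.apply_eq_iff_eq, Fin.rev_inj]; simp
  · rw [energy, dif_pos ⟨hA, hc0⟩, Matrix.IsHermitian.eigenvalues, ← he, Equiv.symm_apply_apply]
  · rw [energy, dif_pos ⟨hA, hc⟩, Matrix.IsHermitian.eigenvalues, ← he, Equiv.symm_apply_apply]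
  · rw [energy, dif_pos ⟨hA, hc⟩]
    refine hA.eigenvalues₀_antitone ?_
    rw [← he]
    have h1 : e.symm i ≠ Fin.rev ⟨0, hc0⟩ := fun h => hi (by rw [← h, Equiv.apply_symm_apply])
    have h2 := (e.symm i).2
    rw [Ne, Fin.ext_iff, Fin.val_rev] at h1
    rw [Fin.le_iff_val_le_val, Fin.val_rev]
    simp only at h1 ⊢; omega

/-- The variational principle for the ground state energy. -/
lemma energy_zero_mul_le {A : Matrix ι ι ℂ} (hA : A.IsHermitian) (φ : EuclideanSpace ℂ ι) :
    energy A 0 * ‖φ‖ ^ 2 ≤ (inner ℂ φ (A ▹ φ)).re := by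
  rw [re_inner_act_eq_sum hA, ← hA.eigenvectorBasis.sum_sq_norm_inner_right, Finset.mul_sum]
  gcongr with i
  exact energy_zero_le_eigenvalues hA i

lemma exists_ground [Nonempty ι] {A : Matrix ι ι ℂ} (hA : A.IsHermitian) :
    ∃ φ : EuclideanSpace ℂ ι, IsGroundState A φ := by
  obtain ⟨i, hi⟩ := exists_eigenvalues_eq_energy_zero hA
  refine ⟨hA.eigenvectorBasis i, hA.eigenvectorBasis.norm_eq_one i, ?_⟩
  rw [act_eigenvectorBasis, hi]

lemma re_inner_of_eigen {A : Matrix ι ι ℂ} {E : ℝ} {φ : EuclideanSpace ℂ ι}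
    (h : A ▹ φ = (E : ℂ) • φ) : (inner ℂ φ (A ▹ φ)).re = E * ‖φ‖ ^ 2 := by
  rw [h, inner_smul_right, inner_self_eq_norm_sq_to_K]
  simp [← Complex.ofReal_pow]

/-- In the presence of a gap, an approximate eigenvector `φ` whose approximate eigenvalue `E` lies
at least `δ` below the first excited level is close to the ground state. -/
lemma norm_sq_sub_overlap_le {A : Matrix ι ι ℂ} (hA : A.IsHermitian) (hc : 1 < Fintype.card ι)
    {ψ : EuclideanSpace ℂ ι} (hψ : IsGroundState A ψ) (hgap : 0 < spectralGap A)
    {E δ : ℝ} (hδ : 0 < δ) (hE : E + δ ≤ energy A 1) (φ : EuclideanSpace ℂ ι) :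
    ‖φ‖ ^ 2 - ‖inner ℂ ψ φ‖ ^ 2 ≤ (‖A ▹ φ - (E : ℂ) • φ‖ / δ) ^ 2 := by
  obtain ⟨i₀, i₁, -, h0, -, hge⟩ := exists_two_lowest hA hc
  set b := hA.eigenvectorBasis with hb
  have hort : ∀ i, i ≠ i₀ → inner ℂ (b i) ψ = 0 := by
    intro i hi
    have h1 := inner_basis_act hA i ψ
    rw [hψ.2, inner_smul_right] at h1
    by_contra h
    have h2 := Complex.ofReal_inj.mp (mul_right_cancel₀ h h1)
    have := hge i hi
    rw [spectralGap] at hgap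
    linarith
  have hψe : ψ = inner ℂ (b i₀) ψ • b i₀ := by
    conv_lhs => rw [← b.sum_repr' ψ]
    exact Finset.sum_eq_single i₀ (fun i _ hi => by rw [hort i hi, zero_smul]) (by simp)
  have hn : ‖inner ℂ (b i₀) ψ‖ = 1 := by
    have := hψ.1
    rw [hψe, norm_smul, b.norm_eq_one, mul_one] at this
    exact this
  have hov : ‖inner ℂ ψ φ‖ = ‖inner ℂ (b i₀) φ‖ := by
    conv_lhs => rw [hψe, inner_smul_left, norm_mul, RCLike.norm_conj, hn, one_mul]
  rw [hov, div_pow, le_div_iff₀ (by positivity), ← b.sum_sq_norm_inner_right φ,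
    ← b.sum_sq_norm_inner_right (A ▹ φ - _), ← Finset.add_sum_erase _ _ (Finset.mem_univ i₀),
    add_sub_cancel_left, Finset.sum_mul]
  calc _ ≤ ∑ i ∈ Finset.univ.erase i₀, ‖inner ℂ (b i) (A ▹ φ - (E : ℂ) • φ)‖ ^ 2 := by
        refine Finset.sum_le_sum fun i hi => ?_
        have hi' := hge i (Finset.ne_of_mem_erase hi)
        rw [inner_sub_right, hb, inner_basis_act, inner_smul_right, ← sub_mul, norm_mul, mul_pow,
          mul_comm, ← Complex.ofReal_sub, Complex.norm_real, Real.norm_eq_abs, sq_abs]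
        gcongr
        linarith
    _ ≤ _ := Finset.sum_le_sum_of_subset_of_nonneg (Finset.erase_subset _ _)
        (fun _ _ _ => by positivity)

end Spectral

/-! ### Functions of a derivation `[K, ·]` -/

section Schur

variable {ι : Type*} [Fintype ι] [DecidableEq ι] {K : Matrix ι ι ℂ}

/-- The function `F` of the derivation `[K, ·]`: in an eigenbasis of the Hermitian matrix `K`, the
entry `Γ i j` is multiplied by `F (E i - E j)`. -/
def adFun (hK : K.IsHermitian) (F : ℝ → ℂ) (Γ : Matrix ι ι ℂ) : Matrix ι ι ℂ :=
  (hK.eigenvectorUnitary : Matrix ι ι ℂ) *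
    Matrix.of (fun i j => F (hK.eigenvalues i - hK.eigenvalues j) *
      ((star hK.eigenvectorUnitary : Matrix ι ι ℂ) * Γ * (hK.eigenvectorUnitary : Matrix ι ι ℂ)) i j) *
    (star hK.eigenvectorUnitary : Matrix ι ι ℂ)

/-- The function `f` of `K`, with complex values. -/
def diagFun (hK : K.IsHermitian) (f : ℝ → ℂ) : Matrix ι ι ℂ :=
  (hK.eigenvectorUnitary : Matrix ι ι ℂ) * Matrix.diagonal (fun i => f (hK.eigenvalues i)) *
    (star hK.eigenvectorUnitary : Matrix ι ι ℂ)

lemma diagFun_eq_cfc (hK : K.IsHermitian) (f : ℝ → ℝ) :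
    diagFun hK (fun x => (f x : ℂ)) = cfc f K := by
  rw [hK.cfc_eq, Matrix.IsHermitian.cfc, Unitary.conjStarAlgAut_apply]
  rfl

lemma norm_diagFun_le (hK : K.IsHermitian) {f : ℝ → ℂ} (hf : ∀ x, ‖f x‖ ≤ 1) :
    ‖diagFun hK f‖ ≤ 1 := by
  rw [diagFun, ← Unitary.coe_star, CStarRing.norm_mul_coe_unitary, CStarRing.norm_coe_unitary_mul,
    Matrix.l2_opNorm_diagonal]
  exact (pi_norm_le_iff_of_nonneg zero_le_one).mpr fun i => hf _

lemma adFun_congr (hK : K.IsHermitian) {F F' : ℝ → ℂ}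
    (h : ∀ i j, F (hK.eigenvalues i - hK.eigenvalues j) = F' (hK.eigenvalues i - hK.eigenvalues j))
    (Γ : Matrix ι ι ℂ) : adFun hK F Γ = adFun hK F' Γ := by
  simp only [adFun, h]

lemma adFun_add (hK : K.IsHermitian) (F : ℝ → ℂ) (Γ Γ' : Matrix ι ι ℂ) :
    adFun hK F (Γ + Γ') = adFun hK F Γ + adFun hK F Γ' := by
  simp only [adFun, ← mul_add, ← add_mul]
  congr 2
  ext i j
  simp [mul_add, add_mul]

lemma adFun_smul (hK : K.IsHermitian) (F : ℝ → ℂ) (c : ℂ) (Γ : Matrix ι ι ℂ) :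
    adFun hK F (c • Γ) = c • adFun hK F Γ := by
  unfold adFun
  rw [← Matrix.smul_mul, ← Matrix.mul_smul]
  congr 2
  ext i j
  simp only [Matrix.smul_mul, Matrix.mul_smul, Matrix.smul_apply, Matrix.of_apply, smul_eq_mul]
  ring

lemma adFun_fun_sum (hK : K.IsHermitian) {κ : Type*} (s : Finset κ) (F : κ → ℝ → ℂ)
    (Γ : Matrix ι ι ℂ) : adFun hK (fun x => ∑ k ∈ s, F k x) Γ = ∑ k ∈ s, adFun hK (F k) Γ := by
  simp only [adFun, ← Finset.mul_sum, ← Finset.sum_mul]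
  congr 2
  ext i j
  simp [Finset.sum_mul, Matrix.sum_apply]

lemma adFun_fun_add (hK : K.IsHermitian) (F F' : ℝ → ℂ)
    (Γ : Matrix ι ι ℂ) : adFun hK (fun x => F x + F' x) Γ = adFun hK F Γ + adFun hK F' Γ := by
  simp only [adFun, ← mul_add, ← add_mul]
  congr 2
  ext i j
  simp [add_mul]

lemma adFun_fun_smul (hK : K.IsHermitian) (c : ℂ) (F : ℝ → ℂ) (Γ : Matrix ι ι ℂ) :
    adFun hK (fun x => c * F x) Γ = c • adFun hK F Γ := by
  unfold adFun
  rw [← Matrix.smul_mul, ← Matrix.mul_smul]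
  congr 2
  ext i j
  simp only [Matrix.smul_apply, Matrix.of_apply, smul_eq_mul]
  ring

/-- The functions of `[K, ·]` are multiplied by composition. -/
lemma adFun_comp (hK : K.IsHermitian) (F F' : ℝ → ℂ) (Γ : Matrix ι ι ℂ) :
    adFun hK F (adFun hK F' Γ) = adFun hK (fun x => F x * F' x) Γ := by
  have h : ∀ M : Matrix ι ι ℂ, (star hK.eigenvectorUnitary : Matrix ι ι ℂ) *
      ((hK.eigenvectorUnitary : Matrix ι ι ℂ) * M * (star hK.eigenvectorUnitary : Matrix ι ι ℂ)) *
      (hK.eigenvectorUnitary : Matrix ι ι ℂ) = M := by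
    intro M
    have h1 := Unitary.coe_star_mul_self hK.eigenvectorUnitary
    calc _ = ((star hK.eigenvectorUnitary : Matrix ι ι ℂ) * (hK.eigenvectorUnitary : Matrix ι ι ℂ))
        * M * ((star hK.eigenvectorUnitary : Matrix ι ι ℂ) *
          (hK.eigenvectorUnitary : Matrix ι ι ℂ)) := by noncomm_ring
      _ = M := by rw [h1, one_mul, mul_one]
  unfold adFun
  rw [h]
  congr 2
  ext i j
  simp [mul_assoc]

/-- Functions `F` that factorize, `F (x - y) = f x * f' y`, act by multiplications from the left and
from the right. -/
lemma adFun_of_mul (hK : K.IsHermitian) {F f f' : ℝ → ℂ} (h : ∀ x y, F (x - y) = f x * f' y)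
    (Γ : Matrix ι ι ℂ) : adFun hK F Γ = diagFun hK f * Γ * diagFun hK f' := by
  have : Matrix.of (fun i j => F (hK.eigenvalues i - hK.eigenvalues j) *
      ((star hK.eigenvectorUnitary : Matrix ι ι ℂ) * Γ *
        (hK.eigenvectorUnitary : Matrix ι ι ℂ)) i j) =
      Matrix.diagonal (fun i => f (hK.eigenvalues i)) *
      ((star hK.eigenvectorUnitary : Matrix ι ι ℂ) * Γ *
        (hK.eigenvectorUnitary : Matrix ι ι ℂ)) *
      Matrix.diagonal (fun i => f' (hK.eigenvalues i)) := by
    ext i j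
    rw [Matrix.mul_diagonal, Matrix.diagonal_mul, Matrix.of_apply, h]
    ring
  rw [adFun, this, diagFun, diagFun]
  noncomm_ring

lemma diagFun_id (hK : K.IsHermitian) : diagFun hK (fun x => (x : ℂ)) = K := by
  rw [diagFun_eq_cfc hK (fun x => x)]
  exact cfc_id' ℝ K hK.isSelfAdjoint

lemma diagFun_one (hK : K.IsHermitian) : diagFun hK (fun _ => 1) = 1 := by
  have : Matrix.diagonal (fun _ : ι => (1 : ℂ)) = 1 := Matrix.diagonal_one
  rw [diagFun, this, mul_one]
  exact Unitary.coe_mul_star_self _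

lemma adFun_one (hK : K.IsHermitian) (Γ : Matrix ι ι ℂ) : adFun hK (fun _ => 1) Γ = Γ := by
  rw [adFun_of_mul hK (f := fun _ => 1) (f' := fun _ => 1) (by simp), diagFun_one, one_mul, mul_one]

lemma adFun_id (hK : K.IsHermitian) (Γ : Matrix ι ι ℂ) : adFun hK (fun x => (x : ℂ)) Γ = ⁅K, Γ⁆ := by
  have key : adFun hK (fun x => (x : ℂ)) Γ = diagFun hK (fun x => (x : ℂ)) * Γ * diagFun hK (fun _ => 1)
      - diagFun hK (fun _ => 1) * Γ * diagFun hK (fun x => (x : ℂ)) := by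
    have e1 : ∀ f f' : ℝ → ℂ, diagFun hK f * Γ * diagFun hK f' =
        (hK.eigenvectorUnitary : Matrix ι ι ℂ) * (Matrix.diagonal (fun i => f (hK.eigenvalues i)) *
        ((star hK.eigenvectorUnitary : Matrix ι ι ℂ) * Γ * (hK.eigenvectorUnitary : Matrix ι ι ℂ)) *
        Matrix.diagonal (fun i => f' (hK.eigenvalues i))) *
        (star hK.eigenvectorUnitary : Matrix ι ι ℂ) := by
      intro f f'; unfold diagFun; noncomm_ring
    rw [e1, e1, adFun, ← sub_mul, ← mul_sub]
    congr 2
    ext i j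
    rw [Matrix.sub_apply, Matrix.mul_diagonal, Matrix.diagonal_mul, Matrix.mul_diagonal,
      Matrix.diagonal_mul, Matrix.of_apply]
    push_cast
    ring
  rw [key, diagFun_id, diagFun_one, one_mul, mul_one, Ring.lie_def]

lemma adFun_pow (hK : K.IsHermitian) (m : ℕ) (Γ : Matrix ι ι ℂ) :
    adFun hK (fun x => (x : ℂ) ^ m) Γ = (fun A => ⁅K, A⁆)^[m] Γ := by
  induction m with
  | zero => simp [adFun_one]
  | succ m ih =>
    rw [Function.iterate_succ_apply', ← ih, ← adFun_id hK, adFun_comp]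
    simp only [pow_succ']

lemma hasSum_adFun (hK : K.IsHermitian) {f : ℕ → ℝ → ℂ} {F : ℝ → ℂ}
    (h : ∀ i j, HasSum (fun m => f m (hK.eigenvalues i - hK.eigenvalues j))
      (F (hK.eigenvalues i - hK.eigenvalues j))) (Γ : Matrix ι ι ℂ) :
    HasSum (fun m => adFun hK (f m) Γ) (adFun hK F Γ) := by
  unfold adFun
  refine HasSum.mul_right _ (HasSum.mul_left _ ?_)
  refine Pi.hasSum.mpr fun i => Pi.hasSum.mpr fun j => ?_
  exact (h i j).mul_right _

/-- If `L` commutes with `K` and with `Γ`, then `[K + L, ·]` and `[K, ·]`, and hence all functions of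
these derivations, agree on `Γ`. -/
lemma adFun_add_commute {L : Matrix ι ι ℂ} (hK : K.IsHermitian) (hKL : (K + L).IsHermitian)
    (h1 : Commute L K) {Γ : Matrix ι ι ℂ} (h2 : Commute L Γ) (F : ℝ → ℂ) :
    adFun hKL F Γ = adFun hK F Γ := by
  -- on the finitely many differences of eigenvalues, `F` is a polynomial
  obtain ⟨p, hp1, hp2⟩ : ∃ p : Polynomial ℂ,
      (∀ i j, F (hK.eigenvalues i - hK.eigenvalues j)
        = p.eval ((hK.eigenvalues i - hK.eigenvalues j : ℝ) : ℂ)) ∧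
      (∀ i j, F (hKL.eigenvalues i - hKL.eigenvalues j)
        = p.eval ((hKL.eigenvalues i - hKL.eigenvalues j : ℝ) : ℂ)) := by
    set S : Finset ℝ := (Finset.univ.image fun x : ι × ι => hK.eigenvalues x.1 - hK.eigenvalues x.2)
      ∪ (Finset.univ.image fun x : ι × ι => hKL.eigenvalues x.1 - hKL.eigenvalues x.2)
    have hS : Set.InjOn (fun x : ℝ => (x : ℂ)) S := Complex.ofReal_injective.injOn
    refine ⟨Lagrange.interpolate S (fun x : ℝ => (x : ℂ)) F, fun i j => ?_, fun i j => ?_⟩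
    · exact (Lagrange.eval_interpolate_at_node F hS (Finset.mem_union_left _
        (Finset.mem_image_of_mem _ (Finset.mem_univ (i, j))))).symm
    · exact (Lagrange.eval_interpolate_at_node F hS (Finset.mem_union_right _
        (Finset.mem_image_of_mem _ (Finset.mem_univ (i, j))))).symm
  have hpow : ∀ m, (fun A => ⁅K + L, A⁆)^[m] Γ = (fun A => ⁅K, A⁆)^[m] Γ ∧
      Commute L ((fun A => ⁅K, A⁆)^[m] Γ) := by
    intro m
    induction m with
    | zero => exact ⟨rfl, h2⟩
    | succ m ih =>
      rw [Function.iterate_succ_apply', Function.iterate_succ_apply', ih.1]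
      refine ⟨?_, ?_⟩
      · rw [Ring.lie_def, Ring.lie_def, add_mul, mul_add, ih.2.eq]
        abel
      · rw [Ring.lie_def]
        exact (h1.mul_right ih.2).sub_right (ih.2.mul_right h1)
  rw [adFun_congr hK (F' := fun x => p.eval (x : ℂ)) hp1,
    adFun_congr hKL (F' := fun x => p.eval (x : ℂ)) hp2]
  simp only [Polynomial.eval_eq_sum_range]
  rw [adFun_fun_sum, adFun_fun_sum]
  refine Finset.sum_congr rfl fun m _ => ?_
  rw [adFun_fun_smul, adFun_fun_smul, adFun_pow, adFun_pow, (hpow m).1]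

/-- `cos (a + b [K, ·])` is an average of two unitary conjugations up to phases, so it is a
contraction. -/
lemma norm_adFun_cos_le (hK : K.IsHermitian) (a b : ℝ) (Γ : Matrix ι ι ℂ) :
    ‖adFun hK (fun x => (Real.cos (a + b * x) : ℂ)) Γ‖ ≤ ‖Γ‖ := by
  have hexp : ∀ t : ℝ, ‖Complex.exp (t * Complex.I)‖ = 1 := Complex.norm_exp_ofReal_mul_I
  have hb : ∀ a b : ℝ, ‖adFun hK (fun x => Complex.exp ((a + b * x : ℝ) * Complex.I)) Γ‖ ≤ ‖Γ‖ := by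
    intro a b
    rw [adFun_of_mul hK (f := fun x => Complex.exp ((a + b * x : ℝ) * Complex.I))
      (f' := fun y => Complex.exp ((-(b * y) : ℝ) * Complex.I))]
    · calc _ ≤ 1 * ‖Γ‖ * 1 := by
            refine (norm_mul_le _ _).trans ?_
            gcongr
            · refine (norm_mul_le _ _).trans ?_
              gcongr
              exact norm_diagFun_le hK fun x => (hexp _).le
            · exact norm_diagFun_le hK fun x => (hexp _).le
        _ = ‖Γ‖ := by ring
    · intro x y
      rw [← Complex.exp_add]
      congr 1
      push_cast
      ring
  have : (fun x : ℝ => (Real.cos (a + b * x) : ℂ)) =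
      fun x : ℝ => (1 / 2 : ℂ) * (Complex.exp ((a + b * x : ℝ) * Complex.I)
        + Complex.exp ((-a + (-b) * x : ℝ) * Complex.I)) := by
    funext x
    rw [Complex.ofReal_cos, Complex.cos]
    push_cast
    ring_nf
  rw [this, adFun_fun_smul, adFun_fun_add, norm_smul]
  have h1 := hb a b
  have h2 := hb (-a) (-b)
  have h3 := norm_add_le (adFun hK (fun x => Complex.exp ((a + b * x : ℝ) * Complex.I)) Γ)
    (adFun hK (fun x => Complex.exp ((-a + (-b) * x : ℝ) * Complex.I)) Γ)
  have h4 : ‖(1 / 2 : ℂ)‖ = 1 / 2 := by norm_num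
  rw [h4]
  linarith

/-- The `m`-th term of the Fourier series of the triangle wave of period `4 σ` that equals `x` on
`[-σ, σ]`; it is written with two cosines since it is obtained from two values of the series
`∑ cos (2 π m x) / m ^ 2`. The term `m = 0` vanishes because `1 / 0 = 0`. -/
def triangleTerm (σ : ℝ) (m : ℕ) (x : ℝ) : ℂ :=
  (4 * σ / Real.pi ^ 2 * (1 / (m : ℝ) ^ 2) : ℝ) *
    ((Real.cos (2 * Real.pi * m * (1 / 4) + -(2 * Real.pi * m / (4 * σ)) * x) : ℂ) +
      (-1) * (Real.cos (2 * Real.pi * m * (3 / 4) + -(2 * Real.pi * m / (4 * σ)) * x) : ℂ))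

lemma hasSum_cos_div_sq {x : ℝ} (hx : x ∈ Set.Icc (0 : ℝ) 1) :
    HasSum (fun m : ℕ => 1 / (m : ℝ) ^ 2 * Real.cos (2 * Real.pi * m * x))
      (Real.pi ^ 2 * (x ^ 2 - x + 1 / 6)) := by
  have h := hasSum_one_div_nat_pow_mul_cos (k := 1) one_ne_zero hx
  convert h using 1
  have h2 : Polynomial.bernoulli 2 = Polynomial.X ^ 2 - Polynomial.X + Polynomial.C (6⁻¹ : ℚ) := by
    rw [Polynomial.bernoulli_def]
    simp only [Finset.sum_range_succ, Finset.sum_range_zero, ← Polynomial.C_mul_X_pow_eq_monomial]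
    norm_num
    ring
  have h3 : Polynomial.eval x (Polynomial.map (algebraMap ℚ ℝ) (Polynomial.bernoulli (2 * 1)))
      = x ^ 2 - x + 1 / 6 := by
    simp [h2]
  rw [h3, show Nat.factorial (2 * 1) = 2 from rfl]
  push_cast
  ring

lemma hasSum_triangleTerm {σ : ℝ} (hσ : 0 < σ) {x : ℝ} (hx : |x| ≤ σ) :
    HasSum (fun m => triangleTerm σ m x) (x : ℂ) := by
  obtain ⟨hx1, hx2⟩ := abs_le.mp hx
  have hd1 : -(1 / 4) ≤ x / (4 * σ) := by rw [le_div_iff₀ (by positivity)]; linarith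
  have hd2 : x / (4 * σ) ≤ 1 / 4 := by rw [div_le_iff₀ (by positivity)]; linarith
  have h1 := hasSum_cos_div_sq (x := 1 / 4 - x / (4 * σ)) ⟨by linarith, by linarith⟩
  have h2 := hasSum_cos_div_sq (x := 3 / 4 - x / (4 * σ)) ⟨by linarith, by linarith⟩
  have h3 := ((h1.sub h2).mul_left (4 * σ / Real.pi ^ 2))
  have h4 := Complex.hasSum_ofReal.mpr h3
  have hpi := Real.pi_pos
  convert h4 using 1
  · funext m
    unfold triangleTerm
    rw [show 2 * Real.pi * m * (1 / 4) + -(2 * Real.pi * m / (4 * σ)) * x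
      = 2 * Real.pi * m * (1 / 4 - x / (4 * σ)) by field_simp; ring,
      show 2 * Real.pi * m * (3 / 4) + -(2 * Real.pi * m / (4 * σ)) * x
      = 2 * Real.pi * m * (3 / 4 - x / (4 * σ)) by field_simp; ring]
    push_cast
    ring
  · congr 1
    field_simp
    ring

lemma norm_adFun_triangleTerm_le (hK : K.IsHermitian) {σ : ℝ} (hσ : 0 < σ) (m : ℕ)
    (Γ : Matrix ι ι ℂ) :
    ‖adFun hK (triangleTerm σ m) Γ‖ ≤ 8 * σ / Real.pi ^ 2 * (1 / (m : ℝ) ^ 2) * ‖Γ‖ := by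
  have h : adFun hK (triangleTerm σ m) Γ = _ := adFun_fun_smul hK _ _ Γ
  have h1 := norm_adFun_cos_le hK (2 * Real.pi * m * (1 / 4)) (-(2 * Real.pi * m / (4 * σ))) Γ
  have h2 := norm_adFun_cos_le hK (2 * Real.pi * m * (3 / 4)) (-(2 * Real.pi * m / (4 * σ))) Γ
  rw [h, adFun_fun_add, adFun_fun_smul, norm_smul, Complex.norm_real, Real.norm_eq_abs,
    abs_of_nonneg (by positivity)]
  calc _ ≤ 4 * σ / Real.pi ^ 2 * (1 / (m : ℝ) ^ 2) * (‖Γ‖ + ‖Γ‖) := by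
        gcongr
        refine (norm_add_le _ _).trans (add_le_add h1 ?_)
        rw [norm_smul, norm_neg, norm_one, one_mul]
        exact h2
    _ = _ := by ring

lemma abs_eigenvalues_le (hK : K.IsHermitian) (i : ι) : |hK.eigenvalues i| ≤ ‖K‖ := by
  have h := norm_act_le K (hK.eigenvectorBasis i)
  rwa [act_eigenvectorBasis, norm_smul, hK.eigenvectorBasis.norm_eq_one, mul_one, mul_one,
    Complex.norm_real, Real.norm_eq_abs] at h

/-- The commutator with `K` as a series of contractions, since the eigenvalues of `[K, ·]` lie in
`[-2 ‖K‖, 2 ‖K‖]`. -/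
lemma hasSum_lie (hK : K.IsHermitian) {σ : ℝ} (hσ : 0 < σ) (h : 2 * ‖K‖ ≤ σ) (Γ : Matrix ι ι ℂ) :
    HasSum (fun m => adFun hK (triangleTerm σ m) Γ) ⁅K, Γ⁆ := by
  rw [← adFun_id hK]
  refine hasSum_adFun hK (fun i j => hasSum_triangleTerm hσ ?_) Γ
  have h1 := abs_eigenvalues_le hK i
  have h2 := abs_eigenvalues_le hK j
  rw [abs_le] at h1 h2 ⊢
  constructor <;> linarith

/-- The estimate of **Bernstein's inequality**, for a commutator that is given by the same Fourier
series as in `hasSum_lie`. -/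
lemma norm_lie_le_of_hasSum (hK : K.IsHermitian) {σ : ℝ} (hσ : 0 < σ) {Γ : Matrix ι ι ℂ}
    (h : HasSum (fun m => adFun hK (triangleTerm σ m) Γ) ⁅K, Γ⁆) :
    ‖⁅K, Γ⁆‖ ≤ 4 / 3 * σ * ‖Γ‖ := by
  have hpi := Real.pi_pos
  have h1 := (hasSum_zeta_two.mul_left (8 * σ / Real.pi ^ 2)).mul_right ‖Γ‖
  have h2 := h.norm_le_of_bounded h1 (norm_adFun_triangleTerm_le hK hσ · Γ)
  convert h2 using 1
  field_simp
  ring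

/-- The imaginary time evolution of `V` under `K`, bounded by the nested commutators. -/
lemma norm_exp_conj_le (hK : K.IsHermitian) {V : Matrix ι ι ℂ} {t C v : ℝ} (ht : 0 ≤ t)
    (htC : t * C ≤ 1 / 2) (hC : 0 ≤ C) (hv : 0 ≤ v)
    (h : ∀ m : ℕ, ‖(fun A => ⁅K, A⁆)^[m] V‖ ≤ C ^ m * m.factorial * v) :
    ‖cfc (fun x => Real.exp (t * x)) K * V * cfc (fun x => Real.exp (-t * x)) K‖ ≤ 2 * v := by
  have hs : HasSum (fun m : ℕ => adFun hK (fun x => (t ^ m / m.factorial : ℂ) * (x : ℂ) ^ m) V)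
      (adFun hK (fun x => Complex.exp (t * x)) V) := by
    refine hasSum_adFun hK (fun i j => ?_) V
    have := NormedSpace.expSeries_div_hasSum_exp (𝔸 := ℂ)
      ((t : ℂ) * ((hK.eigenvalues i - hK.eigenvalues j : ℝ) : ℂ))
    rw [← Complex.exp_eq_exp_ℂ] at this
    refine this.congr_fun fun m => ?_
    rw [mul_pow]; ring
  rw [adFun_of_mul hK (f := fun x => ((Real.exp (t * x) : ℝ) : ℂ))
    (f' := fun x => ((Real.exp (-t * x) : ℝ) : ℂ)), diagFun_eq_cfc hK (fun x => Real.exp (t * x)),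
    diagFun_eq_cfc hK (fun x => Real.exp (-t * x))] at hs
  · have h2 := (hasSum_geometric_two).mul_right v
    refine hs.norm_le_of_bounded h2 fun m => ?_
    rw [adFun_fun_smul, adFun_pow, norm_smul]
    have : ‖(t ^ m / m.factorial : ℂ)‖ = t ^ m / m.factorial := by
      rw [norm_div, norm_pow, Complex.norm_real, Real.norm_eq_abs, abs_of_nonneg ht,
        Complex.norm_natCast]
    rw [this]
    calc _ ≤ t ^ m / m.factorial * (C ^ m * m.factorial * v) := by gcongr; exact h m
      _ = (t * C) ^ m * v := by
        have : (m.factorial : ℝ) ≠ 0 := by positivity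
        rw [mul_pow]; field_simp
      _ ≤ (1 / 2) ^ m * v := by gcongr
  · intro x y
    rw [← Complex.ofReal_mul, ← Complex.ofReal_mul, ← Real.exp_add, Complex.ofReal_exp]
    congr 2
    ring

end Schur

/-! ### Operators on few sites -/

section Locality

variable {n d : ℕ}

/-- `A = a ⊗ 1` with `a` acting on the sites in `X`, expressed through the matrix entries of `A`. -/
def ActsOn (X : Finset (Fin n)) (A : Op n d) : Prop :=
  (∀ x y, (∃ i, i ∉ X ∧ x i ≠ y i) → A x y = 0) ∧
  ∀ x y x' y', (∀ i ∈ X, x i = x' i) → (∀ i ∈ X, y i = y' i) → (∀ i, i ∉ X → x i = y i) →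
    (∀ i, i ∉ X → x' i = y' i) → A x y = A x' y'

lemma SupportedOn.actsOn {X : Finset (Fin n)} {A : Op n d} (h : SupportedOn X A) : ActsOn X A := by
  obtain ⟨a, ha⟩ := h
  refine ⟨fun x y hxy => (ha x y).2 hxy, fun x y x' y' h1 h2 h3 h4 => ?_⟩
  rw [(ha x y).1 h3, (ha x' y').1 h4]
  congr 1
  · funext i; exact h1 i i.2
  · funext i; exact h2 i i.2

lemma ActsOn.mono {X Y : Finset (Fin n)} {A : Op n d} (h : ActsOn X A) (hXY : X ⊆ Y) :
    ActsOn Y A := by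
  refine ⟨fun x y ⟨i, hi, hxy⟩ => h.1 x y ⟨i, fun hX => hi (hXY hX), hxy⟩,
    fun x y x' y' h1 h2 h3 h4 => ?_⟩
  by_cases hc : ∀ i, i ∉ X → x i = y i
  · refine h.2 x y x' y' (fun i hi => h1 i (hXY hi)) (fun i hi => h2 i (hXY hi)) hc fun i hi => ?_
    by_cases hY : i ∈ Y
    · rw [← h1 i hY, ← h2 i hY, hc i hi]
    · exact h4 i hY
  · push Not at hc
    obtain ⟨i, hi, hne⟩ := hc
    have hY : i ∈ Y := by
      by_contra hY
      exact hne (h3 i hY)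
    rw [h.1 x y ⟨i, hi, hne⟩, h.1 x' y' ⟨i, hi, by rwa [← h1 i hY, ← h2 i hY]⟩]

lemma ActsOn.sum {X : Finset (Fin n)} {κ : Type*} {s : Finset κ} {A : κ → Op n d}
    (h : ∀ j ∈ s, ActsOn X (A j)) : ActsOn X (∑ j ∈ s, A j) := by
  refine ⟨fun x y hxy => ?_, fun x y x' y' h1 h2 h3 h4 => ?_⟩
  · rw [Matrix.sum_apply]
    exact Finset.sum_eq_zero fun j hj => (h j hj).1 x y hxy
  · rw [Matrix.sum_apply, Matrix.sum_apply]
    exact Finset.sum_congr rfl fun j hj => (h j hj).2 x y x' y' h1 h2 h3 h4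

lemma ActsOn.smul {X : Finset (Fin n)} {A : Op n d} (h : ActsOn X A) (c : ℂ) :
    ActsOn X (c • A) := by
  refine ⟨fun x y hxy => ?_, fun x y x' y' h1 h2 h3 h4 => ?_⟩
  · rw [Matrix.smul_apply, h.1 x y hxy, smul_zero]
  · rw [Matrix.smul_apply, Matrix.smul_apply, h.2 x y x' y' h1 h2 h3 h4]

/-- Operators on disjoint sets of sites commute. -/
lemma ActsOn.commute {X Z : Finset (Fin n)} {A B : Op n d} (hA : ActsOn X A) (hB : ActsOn Z B)
    (hXZ : Disjoint X Z) : Commute A B := by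
  have hdis : ∀ i, i ∈ X → i ∉ Z := fun i hi hZ => (Finset.disjoint_left.mp hXZ) hi hZ
  have key : ∀ {X Z : Finset (Fin n)} {A B : Op n d}, ActsOn X A → ActsOn Z B →
      (∀ i, i ∈ X → i ∉ Z) → ∀ x y, (A * B) x y =
        A x (fun i => if i ∈ X then y i else x i) * B (fun i => if i ∈ X then y i else x i) y := by
    intro X Z A B hA hB hdis x y
    rw [Matrix.mul_apply]
    refine Finset.sum_eq_single _ (fun w _ hw => ?_) (by simp)
    obtain ⟨i, hi⟩ := Function.ne_iff.mp hw
    by_cases hX : i ∈ X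
    · rw [if_pos hX] at hi
      rw [hB.1 w y ⟨i, hdis i hX, hi⟩, mul_zero]
    · rw [if_neg hX] at hi
      rw [hA.1 x w ⟨i, hX, fun h => hi h.symm⟩, zero_mul]
  change A * B = B * A
  ext x y
  rw [key hA hB hdis, key hB hA (fun i hZ hX => hdis i hX hZ)]
  by_cases hc : ∀ i, i ∉ X → i ∉ Z → x i = y i
  · have h1 : A x (fun i => if i ∈ X then y i else x i) =
        A (fun i => if i ∈ Z then y i else x i) y := by
      refine hA.2 _ _ _ _ (fun i hi => ?_) (fun i hi => ?_) (fun i hi => ?_) (fun i hi => ?_)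
      · simp [hdis i hi]
      · simp [hi]
      · simp [hi]
      · by_cases hZ : i ∈ Z
        · simp [hZ]
        · simpa [hZ] using hc i hi hZ
    have h2 : B (fun i => if i ∈ X then y i else x i) y =
        B x (fun i => if i ∈ Z then y i else x i) := by
      refine hB.2 _ _ _ _ (fun i hi => ?_) (fun i hi => ?_) (fun i hi => ?_) (fun i hi => ?_)
      · have hX : i ∉ X := fun h => hdis i h hi
        simp [hX]
      · simp [hi]
      · by_cases hX : i ∈ X
        · simp [hX]
        · simpa [hX] using hc i hX hi
      · simp [hi]
    rw [h1, h2, mul_comm]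
  · push Not at hc
    obtain ⟨i, hX, hZ, hne⟩ := hc
    rw [hB.1 _ y ⟨i, hZ, by simpa [hX] using hne⟩, hA.1 _ y ⟨i, hX, by simpa [hZ] using hne⟩,
      mul_zero, mul_zero]

/-- `A` is localized on `X`, in the sense of commutants: it commutes with all the operators that act
outside of `X`. This is equivalent to `ActsOn X A`, and obviously stable under products. -/
def LocalOn (X : Finset (Fin n)) (A : Op n d) : Prop :=
  ∀ (Z : Finset (Fin n)) (B : Op n d), Disjoint X Z → ActsOn Z B → Commute A B

lemma ActsOn.localOn {X : Finset (Fin n)} {A : Op n d} (h : ActsOn X A) : LocalOn X A :=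
  fun _ _ hXZ hB => h.commute hB hXZ

lemma LocalOn.mono {X Y : Finset (Fin n)} {A : Op n d} (h : LocalOn X A) (hXY : X ⊆ Y) :
    LocalOn Y A :=
  fun Z B hYZ hB => h Z B (Finset.disjoint_of_subset_left hXY hYZ) hB

lemma LocalOn.lie {X : Finset (Fin n)} {A B : Op n d} (hA : LocalOn X A) (hB : LocalOn X B) :
    LocalOn X ⁅A, B⁆ := by
  intro Z C hXZ hC
  have h1 := hA Z C hXZ hC
  have h2 := hB Z C hXZ hC
  rw [Ring.lie_def]
  exact (h1.mul_left h2).sub_left (h2.mul_left h1)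

/-- The operators that are sums of operators on at most `q` sites each. -/
def fewBody (n d q : ℕ) : Submodule ℂ (Op n d) :=
  Submodule.span ℂ {A | ∃ X : Finset (Fin n), X.card ≤ q ∧ LocalOn X A}

lemma lie_sum_left {κ : Type*} (s : Finset κ) (A : κ → Op n d) (Γ : Op n d) :
    ⁅∑ j ∈ s, A j, Γ⁆ = ∑ j ∈ s, ⁅A j, Γ⁆ := by
  simp only [Ring.lie_def, Finset.sum_mul, Finset.mul_sum, Finset.sum_sub_distrib]

lemma lie_smul_left (c : ℂ) (A Γ : Op n d) : ⁅c • A, Γ⁆ = c • ⁅A, Γ⁆ := by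
  simp only [Ring.lie_def, Matrix.smul_mul, Matrix.mul_smul, smul_sub]

lemma lie_add_right (A Γ Γ' : Op n d) : ⁅A, Γ + Γ'⁆ = ⁅A, Γ⁆ + ⁅A, Γ'⁆ := by
  simp only [Ring.lie_def, mul_add, add_mul]
  abel

lemma lie_smul_right (c : ℂ) (A Γ : Op n d) : ⁅A, c • Γ⁆ = c • ⁅A, Γ⁆ := by
  simp only [Ring.lie_def, Matrix.smul_mul, Matrix.mul_smul, smul_sub]

lemma lie_mem_fewBody {k q : ℕ} {T : Finset (Finset (Fin n))} {h : Finset (Fin n) → Op n d}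
    (hact : ∀ Z ∈ T, ActsOn Z (h Z)) (hcard : ∀ Z ∈ T, Z.card ≤ k) {Γ : Op n d}
    (hΓ : Γ ∈ fewBody n d q) : ⁅∑ Z ∈ T, h Z, Γ⁆ ∈ fewBody n d (q + k) := by
  induction hΓ using Submodule.span_induction with
  | mem A hA =>
    obtain ⟨X, hX, hXA⟩ := hA
    rw [lie_sum_left]
    refine Submodule.sum_mem _ fun Z hZ => Submodule.subset_span ⟨X ∪ Z, ?_, ?_⟩
    · exact (Finset.card_union_le _ _).trans (add_le_add hX (hcard Z hZ))
    · exact ((hact Z hZ).localOn.mono Finset.subset_union_right).lie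
        (hXA.mono Finset.subset_union_left)
  | zero => simp [Ring.lie_def]
  | add A B _ _ hA hB => rw [lie_add_right]; exact Submodule.add_mem _ hA hB
  | smul c A _ hA => rw [lie_smul_right]; exact Submodule.smul_mem _ _ hA

end Locality

/-! ### Decomposition into matchings -/

section Matchings

/-- A weighted family of sets, each of which has conflicts (that is, intersects members) of total
weight at most `c`, is a superposition of matchings (families of pairwise disjoint sets) of total
weight `c`. The matchings are built greedily: a new set `Z` is added to the fraction `θ` of the
matchings that it does not conflict with. -/
lemma exists_matchings {α : Type*} [DecidableEq α] (T : Finset (Finset α)) (w : Finset α → ℝ)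
    {c : ℝ} (hc : 0 ≤ c) (hw : ∀ Z ∈ T, 0 ≤ w Z) (hne : ∀ Z ∈ T, Z.Nonempty)
    (hconf : ∀ Z ∈ T, ∑ Z' ∈ T with ¬ Disjoint Z Z', w Z' ≤ c) :
    ∃ (κ : Type) (_ : Fintype κ) (μ : κ → ℝ) (F : κ → Finset (Finset α)),
      (∀ j, 0 ≤ μ j) ∧ ∑ j, μ j = c ∧ (∀ j, F j ⊆ T) ∧
      (∀ j, (F j : Set (Finset α)).PairwiseDisjoint id) ∧
      ∀ Z ∈ T, ∑ j, (if Z ∈ F j then μ j else 0) = w Z := by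
  induction T using Finset.induction_on with
  | empty =>
    exact ⟨Unit, inferInstance, fun _ => c, fun _ => ∅, fun _ => hc, by simp, by simp, by simp,
      by simp⟩
  | insert Z T hZT ih =>
    obtain ⟨κ, _, μ, F, hμ, hsum, hsub, hdis, hmem⟩ := ih
      (fun Z' h => hw Z' (Finset.mem_insert_of_mem h))
      (fun Z' h => hne Z' (Finset.mem_insert_of_mem h))
      (fun Z' h => (Finset.sum_le_sum_of_subset_of_nonneg
        (Finset.filter_subset_filter _ (Finset.subset_insert _ _))
        (fun Y hY _ => hw Y (Finset.mem_filter.mp hY).1)).trans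
        (hconf Z' (Finset.mem_insert_of_mem h)))
    classical
    set N : κ → Prop := fun j => ∀ Z' ∈ F j, Disjoint Z Z' with hN
    set M : ℝ := ∑ j, (if N j then μ j else 0) with hM
    have hwZ : 0 ≤ w Z := hw Z (Finset.mem_insert_self _ _)
    have hMZ : w Z ≤ M := by
      have h1 : ∑ j, (if N j then 0 else μ j) ≤ ∑ Z' ∈ T with ¬ Disjoint Z Z', w Z' := by
        calc ∑ j, (if N j then 0 else μ j)
            ≤ ∑ j, ∑ Z' ∈ T with ¬ Disjoint Z Z', (if Z' ∈ F j then μ j else 0) := by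
              refine Finset.sum_le_sum fun j _ => ?_
              have hnn : ∀ Z' ∈ T.filter (fun Z' => ¬ Disjoint Z Z'),
                  0 ≤ (if Z' ∈ F j then μ j else 0) := by
                intro Z' _; split_ifs; exacts [hμ j, le_rfl]
              by_cases hj : N j
              · rw [if_pos hj]; exact Finset.sum_nonneg hnn
              · rw [if_neg hj]
                simp only [hN, not_forall] at hj
                obtain ⟨Z', hZ', hd⟩ := hj
                have := Finset.single_le_sum hnn (Finset.mem_filter.mpr ⟨hsub j hZ', hd⟩)
                rwa [if_pos hZ'] at this
          _ = ∑ Z' ∈ T with ¬ Disjoint Z Z', w Z' := by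
              rw [Finset.sum_comm]
              exact Finset.sum_congr rfl fun Z' hZ' => hmem Z' (Finset.mem_filter.mp hZ').1
      have h2 := hconf Z (Finset.mem_insert_self _ _)
      have hZZ : ¬ Disjoint Z Z := by
        rw [disjoint_self]
        exact (hne Z (Finset.mem_insert_self _ _)).ne_empty
      rw [Finset.filter_insert, if_pos hZZ, Finset.sum_insert (by simp [hZT])] at h2
      have h3 : M + ∑ j, (if N j then 0 else μ j) = c := by
        rw [hM, ← Finset.sum_add_distrib, ← hsum]
        refine Finset.sum_congr rfl fun j _ => ?_
        split_ifs <;> simp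
      linarith
    set θ : ℝ := w Z / M with hθ
    have hθ0 : 0 ≤ θ := div_nonneg hwZ (hwZ.trans hMZ)
    have hθ1 : θ ≤ 1 := div_le_one_of_le₀ hMZ (hwZ.trans hMZ)
    have hθM : θ * M = w Z := by
      rcases eq_or_ne M 0 with h0 | h0
      · rw [h0, mul_zero]; linarith
      · rw [hθ, div_mul_cancel₀ _ h0]
    have hZF : ∀ j, Z ∉ F j := fun j h => hZT (hsub j h)
    refine ⟨κ × Bool, inferInstance,
      fun p => if N p.1 then (if p.2 then θ * μ p.1 else (1 - θ) * μ p.1)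
        else (if p.2 then 0 else μ p.1),
      fun p => if N p.1 ∧ p.2 then insert Z (F p.1) else F p.1, ?_, ?_, ?_, ?_, ?_⟩
    · rintro ⟨j, b⟩
      have := hμ j
      have : 0 ≤ 1 - θ := by linarith
      dsimp only
      split_ifs <;> positivity
    · rw [Fintype.sum_prod_type, ← hsum]
      refine Finset.sum_congr rfl fun j _ => ?_
      by_cases hj : N j
      · simp [hj]; ring
      · simp [hj]
    · rintro ⟨j, b⟩
      dsimp only
      split_ifs
      · exact Finset.insert_subset_insert _ (hsub j)
      · exact (hsub j).trans (Finset.subset_insert _ _)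
    · rintro ⟨j, b⟩
      dsimp only
      split_ifs with h
      · rw [Finset.coe_insert]
        exact (hdis j).insert fun Z' hZ' _ => h.1 Z' hZ'
      · exact hdis j
    · intro Z' hZ'
      rw [Fintype.sum_prod_type]
      rcases Finset.mem_insert.mp hZ' with rfl | hT
      · rw [← hθM, hM, Finset.mul_sum]
        refine Finset.sum_congr rfl fun j _ => ?_
        by_cases hj : N j
        · simp [hj, hZF j]
        · simp [hj, hZF j]
      · rw [← hmem Z' hT]
        refine Finset.sum_congr rfl fun j _ => ?_
        have hne' : Z' ≠ Z := fun h => hZT (h ▸ hT)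
        by_cases hj : N j
        · by_cases hF : Z' ∈ F j
          · simp [hj, hF]; ring
          · simp [hj, hF, hne']
        · simp [hj]

end Matchings

/-! ### Commutators of few-body operators -/

section CommutatorBound

variable {n d : ℕ}

lemma isHermitian_sum {ι κ : Type*} {s : Finset κ} {A : κ → Matrix ι ι ℂ}
    (h : ∀ j ∈ s, (A j).IsHermitian) : (∑ j ∈ s, A j).IsHermitian :=
  (isSelfAdjoint_sum s h : IsSelfAdjoint _)

/-- A set of `q` sites meets at most `q` members of a matching. -/
lemma card_filter_not_disjoint_le {α : Type*} [DecidableEq α] {F : Finset (Finset α)}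
    (hF : (F : Set (Finset α)).PairwiseDisjoint id) (X : Finset α) :
    (F.filter fun Z => ¬ Disjoint Z X).card ≤ X.card := by
  have hex : ∀ Z ∈ F.filter (fun Z => ¬ Disjoint Z X), ∃ i ∈ X, i ∈ Z := by
    intro Z hZ
    obtain ⟨i, hi, hi'⟩ := Finset.not_disjoint_iff.mp (Finset.mem_filter.mp hZ).2
    exact ⟨i, hi', hi⟩
  refine Finset.card_le_card_of_forall_subsingleton (fun Z i => i ∈ Z) hex ?_
  rintro i - Z ⟨hZ, hi⟩ Z' ⟨hZ', hi'⟩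
  by_contra hne
  exact Finset.disjoint_left.mp
    (hF (Finset.mem_filter.mp hZ).1 (Finset.mem_filter.mp hZ').1 hne) hi hi'

/-- **Bernstein's inequality** for the commutator of a `q`-body operator with a sum of commuting
contractions that act on pairwise disjoint sets. -/
lemma norm_lie_matching_le {q : ℕ} (hq : 0 < q) {F : Finset (Finset (Fin n))}
    (hF : (F : Set (Finset (Fin n))).PairwiseDisjoint id) {h : Finset (Fin n) → Op n d}
    (hherm : ∀ Z ∈ F, (h Z).IsHermitian) (hact : ∀ Z ∈ F, ActsOn Z (h Z))
    (hnorm : ∀ Z ∈ F, ‖h Z‖ ≤ 1) {Γ : Op n d} (hΓ : Γ ∈ fewBody n d q) :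
    ‖⁅∑ Z ∈ F, h Z, Γ⁆‖ ≤ 8 / 3 * q * ‖Γ‖ := by
  have hK := isHermitian_sum hherm
  have hq' : (0 : ℝ) < 2 * q := by positivity
  -- the series is linear in `Γ`, hence it can be checked on operators on at most `q` sites
  have key : HasSum (fun m => adFun hK (triangleTerm (2 * q) m) Γ) ⁅∑ Z ∈ F, h Z, Γ⁆ := by
    induction hΓ using Submodule.span_induction with
    | mem A hA =>
      obtain ⟨X, hX, hXA⟩ := hA
      -- only the terms that meet `X` contribute to the commutator with an operator on `X`
      set P := F.filter fun Z => ¬ Disjoint Z X with hP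
      set Q := F.filter fun Z => Disjoint Z X with hQ
      have hsplit : ∑ Z ∈ F, h Z = ∑ Z ∈ P, h Z + ∑ Z ∈ Q, h Z := by
        rw [add_comm, hP, hQ, Finset.sum_filter_add_sum_filter_not]
      have hPh : (∑ Z ∈ P, h Z).IsHermitian :=
        isHermitian_sum fun Z hZ => hherm Z (Finset.mem_filter.mp hZ).1
      have hPn : ‖∑ Z ∈ P, h Z‖ ≤ q := by
        calc ‖∑ Z ∈ P, h Z‖ ≤ ∑ Z ∈ P, 1 :=
              norm_sum_le_of_le _ fun Z hZ => hnorm Z (Finset.mem_filter.mp hZ).1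
          _ = (P.card : ℝ) := by simp
          _ ≤ q := by
              exact_mod_cast (card_filter_not_disjoint_le hF X).trans hX
      have hQP : Commute (∑ Z ∈ Q, h Z) (∑ Z ∈ P, h Z) := by
        refine Commute.sum_left _ _ _ fun Z hZ => Commute.sum_right _ _ _ fun Z' hZ' => ?_
        rw [hQ, Finset.mem_filter] at hZ
        rw [hP, Finset.mem_filter] at hZ'
        refine (hact Z hZ.1).commute (hact Z' hZ'.1) (hF hZ.1 hZ'.1 ?_)
        rintro rfl
        exact hZ'.2 hZ.2
      have hQA : Commute (∑ Z ∈ Q, h Z) A := by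
        refine Commute.sum_left _ _ _ fun Z hZ => ?_
        rw [hQ, Finset.mem_filter] at hZ
        exact (hXA Z (h Z) hZ.2.symm (hact Z hZ.1)).symm
      have h1 := hasSum_lie hPh hq' (by linarith) A
      have h2 : ⁅∑ Z ∈ F, h Z, A⁆ = ⁅∑ Z ∈ P, h Z, A⁆ := by
        rw [hsplit, Ring.lie_def, Ring.lie_def, add_mul, mul_add, hQA.eq]
        abel
      rw [h2]
      refine h1.congr_fun fun m => ?_
      have h3 := adFun_add_commute hPh (hsplit ▸ hK) hQP hQA (triangleTerm (2 * q) m)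
      rw [← h3]
      congr 1
    | zero =>
      have : ∀ m, adFun hK (triangleTerm (2 * q) m) 0 = 0 := fun m => by
        have := adFun_smul hK (triangleTerm (2 * q) m) 0 0
        simpa using this
      simp [this, Ring.lie_def, hasSum_zero]
    | add A B _ _ hA hB =>
      simp only [adFun_add, lie_add_right]
      exact hA.add hB
    | smul c A _ hA =>
      simp only [adFun_smul, lie_smul_right]
      exact hA.const_smul c
  have := norm_lie_le_of_hasSum hK hq' key
  linarith

/-- The commutator of a `k`-body Hamiltonian `H = ∑ h_Z` whose one-site energies are at most `g`
with a `q`-body operator `Γ` has norm at most `(8/3) g k q ‖Γ‖`. In contrast to a term by term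
estimate, the bound involves the norm of `Γ` itself. -/
lemma norm_lie_le {k q : ℕ} (hq : 0 < q) {T : Finset (Finset (Fin n))}
    {h : Finset (Fin n) → Op n d} (hherm : ∀ Z ∈ T, (h Z).IsHermitian)
    (hact : ∀ Z ∈ T, ActsOn Z (h Z)) (hcard : ∀ Z ∈ T, Z.card ≤ k) (hne : ∀ Z ∈ T, Z.Nonempty)
    {g : ℝ} (hg0 : 0 ≤ g) (hg : ∀ i, ∑ Z ∈ T with i ∈ Z, ‖h Z‖ ≤ g) {Γ : Op n d}
    (hΓ : Γ ∈ fewBody n d q) :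
    ‖⁅∑ Z ∈ T, h Z, Γ⁆‖ ≤ 8 / 3 * g * k * q * ‖Γ‖ := by
  obtain ⟨κ, _, μ, F, hμ, hsum, hsub, hdis, hmem⟩ := exists_matchings T (fun Z => ‖h Z‖)
    (c := k * g) (by positivity) (fun _ _ => norm_nonneg _) hne (by
      intro Z hZ
      calc ∑ Z' ∈ T with ¬ Disjoint Z Z', ‖h Z'‖
          ≤ ∑ Z' ∈ T with ¬ Disjoint Z Z', ∑ i ∈ Z, (if i ∈ Z' then ‖h Z'‖ else 0) := by
            refine Finset.sum_le_sum fun Z' hZ' => ?_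
            obtain ⟨i, hi, hi'⟩ := Finset.not_disjoint_iff.mp (Finset.mem_filter.mp hZ').2
            have := Finset.single_le_sum (f := fun i => if i ∈ Z' then ‖h Z'‖ else 0)
              (fun i _ => by positivity) hi
            simpa [hi'] using this
        _ ≤ ∑ Z' ∈ T, ∑ i ∈ Z, (if i ∈ Z' then ‖h Z'‖ else 0) :=
            Finset.sum_le_sum_of_subset_of_nonneg (Finset.filter_subset _ _)
              fun _ _ _ => Finset.sum_nonneg fun _ _ => by positivity
        _ = ∑ i ∈ Z, ∑ Z' ∈ T with i ∈ Z', ‖h Z'‖ := by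
            rw [Finset.sum_comm]
            simp only [Finset.sum_filter]
        _ ≤ ∑ i ∈ Z, g := Finset.sum_le_sum fun i _ => hg i
        _ = Z.card * g := by simp
        _ ≤ k * g := by
            gcongr
            exact_mod_cast hcard Z hZ)
  have hdec : ∑ Z ∈ T, h Z = ∑ j, (μ j : ℂ) • ∑ Z ∈ F j, ((‖h Z‖⁻¹ : ℝ) : ℂ) • h Z := by
    have h1 : ∀ j, (μ j : ℂ) • ∑ Z ∈ F j, ((‖h Z‖⁻¹ : ℝ) : ℂ) • h Z =
        ∑ Z ∈ T, ((if Z ∈ F j then μ j else 0 : ℝ) : ℂ) • ((‖h Z‖⁻¹ : ℝ) : ℂ) • h Z := by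
      intro j
      rw [Finset.smul_sum, ← Finset.sum_subset (hsub j)]
      · exact Finset.sum_congr rfl fun Z hZ => by rw [if_pos hZ]
      · intro Z _ hZ
        rw [if_neg hZ, Complex.ofReal_zero, zero_smul]
    simp only [h1]
    rw [Finset.sum_comm]
    refine Finset.sum_congr rfl fun Z hZ => ?_
    rw [← Finset.sum_smul, ← Complex.ofReal_sum, hmem Z hZ, smul_smul, ← Complex.ofReal_mul]
    by_cases h0 : h Z = 0
    · simp [h0]
    · rw [mul_inv_cancel₀ (norm_ne_zero_iff.mpr h0), Complex.ofReal_one, one_smul]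
  rw [hdec, lie_sum_left]
  calc ‖∑ j, ⁅(μ j : ℂ) • ∑ Z ∈ F j, ((‖h Z‖⁻¹ : ℝ) : ℂ) • h Z, Γ⁆‖
      ≤ ∑ j, μ j * (8 / 3 * q * ‖Γ‖) := by
        refine norm_sum_le_of_le _ fun j _ => ?_
        rw [lie_smul_left, norm_smul, Complex.norm_real, Real.norm_eq_abs, abs_of_nonneg (hμ j)]
        refine mul_le_mul_of_nonneg_left ?_ (hμ j)
        refine norm_lie_matching_le hq (hdis j) (fun Z hZ => ?_)
          (fun Z hZ => (hact Z (hsub j hZ)).smul _) (fun Z hZ => ?_) hΓ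
        · have := hherm Z (hsub j hZ)
          unfold Matrix.IsHermitian at this ⊢
          rw [Matrix.conjTranspose_smul, this, RCLike.star_def, Complex.conj_ofReal]
        · rw [norm_smul, Complex.norm_real, norm_inv, norm_norm]
          exact inv_mul_le_one
    _ = 8 / 3 * g * k * q * ‖Γ‖ := by
        rw [← Finset.sum_mul, hsum]; ring

/-- The nested commutators of a `k`-body operator `V` with a `k`-body Hamiltonian. -/
lemma norm_iterate_lie_le {k : ℕ} {T : Finset (Finset (Fin n))}
    {h : Finset (Fin n) → Op n d} (hherm : ∀ Z ∈ T, (h Z).IsHermitian)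
    (hact : ∀ Z ∈ T, ActsOn Z (h Z)) (hcard : ∀ Z ∈ T, Z.card ≤ k) (hne : ∀ Z ∈ T, Z.Nonempty)
    {g : ℝ} (hg0 : 0 ≤ g) (hg : ∀ i, ∑ Z ∈ T with i ∈ Z, ‖h Z‖ ≤ g) {V : Op n d}
    (hV : V ∈ fewBody n d k) (m : ℕ) :
    ‖(fun A => ⁅∑ Z ∈ T, h Z, A⁆)^[m] V‖ ≤ (8 / 3 * g * k ^ 2) ^ m * m.factorial * ‖V‖ := by
  have hmem : ∀ m : ℕ, (fun A => ⁅∑ Z ∈ T, h Z, A⁆)^[m] V ∈ fewBody n d ((m + 1) * k) := by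
    intro m
    induction m with
    | zero => simpa using hV
    | succ m ih =>
      rw [Function.iterate_succ_apply', add_mul (m + 1) 1 k, one_mul]
      exact lie_mem_fewBody hact hcard ih
  induction m with
  | zero => simp
  | succ m ih =>
    rw [Function.iterate_succ_apply']
    rcases Nat.eq_zero_or_pos k with rfl | hk
    · have hT : T = ∅ := Finset.eq_empty_of_forall_notMem fun Z hZ =>
        (Finset.card_pos.mpr (hne Z hZ)).ne' (Nat.le_zero.mp (hcard Z hZ))
      simp [hT, Ring.lie_def]
    refine (norm_lie_le (by positivity) hherm hact hcard hne hg0 hg (hmem m)).trans ?_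
    calc _ ≤ 8 / 3 * g * k * ((m + 1) * k : ℕ) *
          ((8 / 3 * g * k ^ 2) ^ m * m.factorial * ‖V‖) := by gcongr
      _ = _ := by
        rw [Nat.factorial_succ]
        push_cast
        ring

end CommutatorBound

/-! ### High-energy tails of eigenvectors -/

section Tail

variable {ι : Type*} [Fintype ι] [DecidableEq ι] {K R V : Matrix ι ι ℂ}

/-- An Agmon-type estimate. Conjugating the eigenvalue equation with `exp (t K)`, which commutes with
everything but `V`, bounds the weighted average of the capped energy of `K`. -/
lemma agmon_estimate (hK : K.IsHermitian) (hR : R.IsHermitian) (hKR : Commute K R)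
    {t E v c : ℝ}
    (hv : ‖cfc (fun x => Real.exp (t * x)) K * V * cfc (fun x => Real.exp (-t * x)) K‖ ≤ v)
    {φ : EuclideanSpace ℂ ι} (hφ : (cutoff c K + R + V) ▹ φ = (E : ℂ) • φ) :
    ∑ i, Real.exp (t * hK.eigenvalues i) ^ 2 * (min (hK.eigenvalues i) c - (E - energy R 0 + v)) *
      ‖inner ℂ (hK.eigenvectorBasis i) φ‖ ^ 2 ≤ 0 := by
  set G := cfc (fun x => Real.exp (t * x)) K with hG
  set G' := cfc (fun x => Real.exp (-t * x)) K with hG'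
  set ψ := G ▹ φ with hψ
  have hGG : G' * G = 1 := by
    rw [hG, hG', ← cfc_mul (fun x => Real.exp (-t * x)) (fun x => Real.exp (t * x)) K
      (by fun_prop) (by fun_prop)]
    have : (fun x => Real.exp (-t * x) * Real.exp (t * x)) = fun _ => (1 : ℝ) := by
      funext x
      rw [← Real.exp_add]
      simp
    rw [this]
    exact cfc_const_one ℝ K hK.isSelfAdjoint
  have h1 : G * cutoff c K = cutoff c K * G := cfc_commute_cfc _ _ K
  have h2 : G * R = R * G := (hK.isSelfAdjoint.commute_cfc hKR _).eq
  have h3 : G * V = G * V * G' * G := by rw [mul_assoc (G * V), hGG, mul_one]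
  have heq : cutoff c K ▹ ψ + R ▹ ψ + (G * V * G') ▹ ψ = (E : ℂ) • ψ := by
    rw [hψ, ← mul_act, ← mul_act, ← mul_act, ← h1, ← h2, ← h3, mul_act, mul_act, mul_act,
      ← map_add, ← map_add, ← add_act, ← add_act, hφ, map_smul]
  have hin := congrArg (fun χ => (inner ℂ ψ χ).re) heq
  simp only [inner_add_right, Complex.add_re, inner_smul_right, inner_self_eq_norm_sq_to_K] at hin
  have hn : ((E : ℂ) * ((‖ψ‖ : ℝ) : ℂ) ^ 2).re = E * ‖ψ‖ ^ 2 := by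
    rw [← Complex.ofReal_pow, ← Complex.ofReal_mul, Complex.ofReal_re]
  have hin' : (inner ℂ ψ (cutoff c K ▹ ψ)).re + (inner ℂ ψ (R ▹ ψ)).re
      + (inner ℂ ψ ((G * V * G') ▹ ψ)).re = E * ‖ψ‖ ^ 2 := hin.trans hn
  have h4 := energy_zero_mul_le hR ψ
  have h5 := (abs_le.mp (re_inner_act_le (G * V * G') ψ)).1
  have h6 : ‖G * V * G'‖ * ‖ψ‖ ^ 2 ≤ v * ‖ψ‖ ^ 2 := by gcongr
  have h7 : (inner ℂ ψ (cutoff c K ▹ ψ)).re ≤ (E - energy R 0 + v) * ‖ψ‖ ^ 2 := by linarith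
  rw [cutoff, re_inner_cfc hK, ← hK.eigenvectorBasis.sum_sq_norm_inner_right, Finset.mul_sum,
    ← sub_nonpos, ← Finset.sum_sub_distrib] at h7
  refine le_of_eq_of_le (Finset.sum_congr rfl fun i _ => ?_) h7
  rw [hψ, inner_basis_cfc, norm_mul, Complex.norm_real, Real.norm_eq_abs, mul_pow, sq_abs]
  ring

/-- The high-energy tail of an eigenvector decays exponentially with the distance `z` between the
cut-off `c` and the energy that is available to `K`. -/
lemma norm_sub_cutoff_act_le (hK : K.IsHermitian) (hR : R.IsHermitian) (hKR : Commute K R)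
    {t E v c z : ℝ} (ht : 0 < t)
    (hv : ‖cfc (fun x => Real.exp (t * x)) K * V * cfc (fun x => Real.exp (-t * x)) K‖ ≤ v)
    {φ : EuclideanSpace ℂ ι} (hφ : (cutoff c K + R + V) ▹ φ = (E : ℂ) • φ) (hφ1 : ‖φ‖ = 1)
    (hz : c - (E - energy R 0 + v) = z) (htz : 1 ≤ t * z) :
    ‖K ▹ φ - cutoff c K ▹ φ‖ ≤ Real.exp (-(t * z)) / t := by
  have hag := agmon_estimate hK hR hKR hv hφ
  set e := E - energy R 0 + v with he
  have hz0 : 0 < z := pos_of_mul_pos_right (by linarith) ht.le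
  -- the pointwise inequality `(x - min x c) ^ 2 ≤ A * exp (t * x) ^ 2 * (min x c - e) + B`
  have hpt : ∀ x : ℝ, (x - min x c) ^ 2 ≤ Real.exp (-(t * c)) ^ 2 / (t ^ 2 * z) *
      (Real.exp (t * x) ^ 2 * (min x c - e)) + (Real.exp (-(t * z)) / t) ^ 2 := by
    intro x
    have hB : 0 ≤ (Real.exp (-(t * z)) / t) ^ 2 := sq_nonneg _
    rcases le_total x c with hx | hx
    · rw [min_eq_left hx, sub_self, zero_pow two_ne_zero]
      rcases le_total e x with hex | hex
      · have : 0 ≤ x - e := by linarith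
        positivity
      · have h1 : e - x ≤ z * Real.exp (t * (e - x)) ^ 2 := by
          have h2 : t * (e - x) + 1 ≤ Real.exp (t * (e - x)) := Real.add_one_le_exp _
          have h3 : 0 ≤ t * (e - x) := mul_nonneg ht.le (by linarith)
          have h4 : Real.exp (t * (e - x)) ≤ Real.exp (t * (e - x)) ^ 2 := by
            nlinarith
          have h5 : t * (e - x) ≤ t * (z * Real.exp (t * (e - x)) ^ 2) := by
            nlinarith [sq_nonneg (Real.exp (t * (e - x)))]
          exact le_of_mul_le_mul_left h5 ht
        have h6 : Real.exp (-(t * c)) ^ 2 / (t ^ 2 * z) * (Real.exp (t * x) ^ 2 * (x - e))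
            = - (Real.exp (-(t * z)) / t) ^ 2 *
              ((e - x) / (z * Real.exp (t * (e - x)) ^ 2)) := by
          have h7 : Real.exp (-(t * c)) * Real.exp (t * x) * Real.exp (t * (e - x))
              = Real.exp (-(t * z)) := by
            rw [← Real.exp_add, ← Real.exp_add]
            congr 1
            rw [← hz]; ring
          rw [← h7]
          have := Real.exp_pos (t * (e - x))
          field_simp
          ring
        have h8 : (e - x) / (z * Real.exp (t * (e - x)) ^ 2) ≤ 1 :=
          div_le_one_of_le₀ h1 (by positivity)
        rw [h6]
        nlinarith
    · rw [min_eq_right hx, show c - e = z from hz]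
      have h1 : t * (x - c) ≤ Real.exp (t * (x - c)) := by
        linarith [Real.add_one_le_exp (t * (x - c))]
      have h2 : Real.exp (-(t * c)) ^ 2 / (t ^ 2 * z) * (Real.exp (t * x) ^ 2 * z)
          = (Real.exp (t * (x - c)) / t) ^ 2 := by
        rw [show t * (x - c) = -(t * c) + t * x by ring, Real.exp_add]
        field_simp
      rw [h2]
      have h3 : x - c ≤ Real.exp (t * (x - c)) / t := by
        rw [le_div_iff₀ ht]; linarith
      have h4 : (x - c) ^ 2 ≤ (Real.exp (t * (x - c)) / t) ^ 2 :=
        pow_le_pow_left₀ (by linarith) h3 2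
      linarith
  refine abs_le_of_sq_le_sq' ?_ (by positivity) |>.2
  rw [← hK.eigenvectorBasis.sum_sq_norm_inner_right]
  calc ∑ i, ‖inner ℂ (hK.eigenvectorBasis i) (K ▹ φ - cutoff c K ▹ φ)‖ ^ 2
      = ∑ i, (hK.eigenvalues i - min (hK.eigenvalues i) c) ^ 2 *
          ‖inner ℂ (hK.eigenvectorBasis i) φ‖ ^ 2 := by
        refine Finset.sum_congr rfl fun i _ => ?_
        rw [inner_sub_right, inner_basis_act, cutoff, inner_basis_cfc, ← sub_mul, norm_mul,
          mul_pow, ← Complex.ofReal_sub, Complex.norm_real, Real.norm_eq_abs, sq_abs]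
    _ ≤ ∑ i, (Real.exp (-(t * c)) ^ 2 / (t ^ 2 * z) * (Real.exp (t * hK.eigenvalues i) ^ 2 *
          (min (hK.eigenvalues i) c - e)) + (Real.exp (-(t * z)) / t) ^ 2) *
          ‖inner ℂ (hK.eigenvectorBasis i) φ‖ ^ 2 := by
        gcongr with i
        exact hpt _
    _ = Real.exp (-(t * c)) ^ 2 / (t ^ 2 * z) * ∑ i, Real.exp (t * hK.eigenvalues i) ^ 2 *
          (min (hK.eigenvalues i) c - e) * ‖inner ℂ (hK.eigenvectorBasis i) φ‖ ^ 2
          + (Real.exp (-(t * z)) / t) ^ 2 * ‖φ‖ ^ 2 := by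
        rw [← hK.eigenvectorBasis.sum_sq_norm_inner_right φ, Finset.mul_sum, Finset.mul_sum,
          ← Finset.sum_add_distrib]
        exact Finset.sum_congr rfl fun i _ => by ring
    _ ≤ (Real.exp (-(t * z)) / t) ^ 2 := by
        rw [hφ1, one_pow, mul_one]
        have := mul_nonpos_of_nonneg_of_nonpos
          (show 0 ≤ Real.exp (-(t * c)) ^ 2 / (t ^ 2 * z) by positivity) hag
        linarith

lemma re_inner_cutoff_le (hK : K.IsHermitian) (c : ℝ) (φ : EuclideanSpace ℂ ι) :
    (inner ℂ φ (cutoff c K ▹ φ)).re ≤ (inner ℂ φ (K ▹ φ)).re := by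
  rw [cutoff, re_inner_cfc hK, re_inner_act_eq_sum hK]
  gcongr
  exact min_le_left _ _

/-- Comparison of a gapped Hamiltonian `H` with a smaller operator `H'` which almost agrees with `H`
on the low-energy eigenvectors of `H'`. -/
lemma gap_and_ground_state_of_low_energy {H H' : Matrix ι ι ℂ} (hH : H.IsHermitian)
    (hH' : H'.IsHermitian) (hc : 1 < Fintype.card ι) (hgap : 0 < spectralGap H)
    (hle : ∀ φ : EuclideanSpace ℂ ι, (inner ℂ φ (H' ▹ φ)).re ≤ (inner ℂ φ (H ▹ φ)).re)
    {η : ℝ} (hη : η ≤ spectralGap H / 4)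
    (hD : ∀ (φ : EuclideanSpace ℂ ι) (E : ℝ), ‖φ‖ = 1 → H' ▹ φ = (E : ℂ) • φ →
      E ≤ energy H' 0 + spectralGap H / 2 → ‖H ▹ φ - H' ▹ φ‖ ≤ η) :
    spectralGap H / 2 ≤ spectralGap H' ∧
    ∀ ψ φ : EuclideanSpace ℂ ι, IsGroundState H ψ → IsGroundState H' φ →
      0 ≤ (inner ℂ ψ φ).re → (inner ℂ ψ φ).im = 0 → ‖φ - ψ‖ ≤ 2 * (η / spectralGap H) := by
  have : Nonempty ι := Fintype.card_pos_iff.mp (by omega)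
  obtain ⟨ψ₀, hψ₀⟩ := exists_ground hH
  have hEE : energy H' 0 ≤ energy H 0 := by
    have h1 := energy_zero_mul_le hH' ψ₀
    have h2 := hle ψ₀
    rw [re_inner_of_eigen hψ₀.2] at h2
    rw [hψ₀.1] at h1 h2
    linarith
  have hΔ : energy H 1 = energy H 0 + spectralGap H := by rw [spectralGap]; ring
  constructor
  · -- otherwise two orthonormal eigenvectors of `H'` would be close to the ground state of `H`
    by_contra! hlt
    obtain ⟨i₀, i₁, hne, h0, h1, -⟩ := exists_two_lowest hH' hc
    have key : ∀ i, hH'.eigenvalues i ≤ energy H' 0 + spectralGap H / 2 →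
        3 / 4 ≤ ‖inner ℂ (hH'.eigenvectorBasis i) ψ₀‖ ^ 2 := by
      intro i hi
      have hn := hH'.eigenvectorBasis.norm_eq_one i
      have h2 := hD _ _ hn (act_eigenvectorBasis hH' i) hi
      have h3 := norm_sq_sub_overlap_le hH hc hψ₀ hgap (E := hH'.eigenvalues i)
        (δ := spectralGap H / 2) (by positivity) (by linarith) (hH'.eigenvectorBasis i)
      rw [← act_eigenvectorBasis, hn] at h3
      rw [norm_inner_symm]
      have h4 : ‖H ▹ hH'.eigenvectorBasis i - H' ▹ hH'.eigenvectorBasis i‖ / (spectralGap H / 2)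
          ≤ 1 / 2 := by
        rw [div_le_iff₀ (by positivity)]; linarith
      have h5 := pow_le_pow_left₀ (by positivity) h4 2
      linarith
    have h2 := key i₀ (by rw [h0]; linarith)
    have h3 := key i₁ (by rw [h1]; rw [spectralGap] at hlt; linarith)
    have h4 := hH'.eigenvectorBasis.sum_sq_norm_inner_right ψ₀
    have h5 : ∑ i ∈ {i₀, i₁}, ‖inner ℂ (hH'.eigenvectorBasis i) ψ₀‖ ^ 2 ≤
        ∑ i, ‖inner ℂ (hH'.eigenvectorBasis i) ψ₀‖ ^ 2 :=
      Finset.sum_le_sum_of_subset_of_nonneg (Finset.subset_univ _) fun _ _ _ => by positivity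
    rw [Finset.sum_pair hne, h4, hψ₀.1] at h5
    linarith
  · intro ψ φ hψ hφ hre him
    have h1 := hD φ _ hφ.1 hφ.2 (by linarith)
    have h2 := norm_sq_sub_overlap_le hH hc hψ hgap hgap (E := energy H' 0) (by linarith) φ
    rw [← hφ.2, hφ.1] at h2
    have h3 : ‖inner ℂ ψ φ‖ = (inner ℂ ψ φ).re := by
      have : (inner ℂ ψ φ) = (((inner ℂ ψ φ).re : ℝ) : ℂ) := Complex.ext rfl (by simpa using him)
      rw [this, Complex.norm_real, Complex.ofReal_re, Real.norm_eq_abs, abs_of_nonneg hre]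
    have h4 : ‖H ▹ φ - H' ▹ φ‖ / spectralGap H ≤ η / spectralGap H := by gcongr
    have h5 := pow_le_pow_left₀ (by positivity) h4 2
    have h6 : ‖inner ℂ ψ φ‖ ≤ 1 := by
      have := norm_inner_le_norm (𝕜 := ℂ) ψ φ
      rwa [hψ.1, hφ.1, one_mul] at this
    have h7 : ‖φ - ψ‖ ^ 2 = 2 - 2 * (inner ℂ ψ φ).re := by
      rw [norm_sub_rev, @norm_sub_sq ℂ, hψ.1, hφ.1]
      simp only [RCLike.re_to_complex]
      ring
    have hη0 : 0 ≤ η / spectralGap H := le_trans (by positivity) h4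
    rw [h3] at h2 h6
    refine abs_le_of_sq_le_sq' ?_ (by positivity) |>.2
    rw [h7]
    nlinarith

end Tail

/-! ### Degeneracies from operators on few sites -/

section Transfer

variable {n d : ℕ}

/-- The operator `|u(·, ζ)⟩⟨η| ⊗ 1` on the sites in `X`, where `u(·, ζ)` is the slice of the wave
function `u` whose coordinates outside of `X` are given by `ζ`. -/
def transfer (X : Finset (Fin n)) (u : (Fin n → Fin d) → ℂ) (ζ η : Fin n → Fin d) : Op n d :=
  Matrix.of fun x y => if (∀ i, i ∉ X → x i = y i) ∧ (∀ i ∈ X, y i = η i) then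
    u (X.piecewise x ζ) else 0

lemma transfer_actsOn (X : Finset (Fin n)) (u : (Fin n → Fin d) → ℂ) (ζ η : Fin n → Fin d) :
    ActsOn X (transfer X u ζ η) := by
  refine ⟨fun x y ⟨i, hi, hxy⟩ => if_neg fun h => hxy (h.1 i hi), fun x y x' y' h1 h2 h3 h4 => ?_⟩
  have h5 : X.piecewise x ζ = X.piecewise x' ζ :=
    X.piecewise_congr h1 fun _ _ => rfl
  have h6 : (∀ i ∈ X, y i = η i) ↔ ∀ i ∈ X, y' i = η i :=
    forall₂_congr fun i hi => by rw [h2 i hi]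
  simp only [transfer, Matrix.of_apply, h5, h6, eq_true h3, eq_true h4]

lemma transfer_act (X : Finset (Fin n)) (u : (Fin n → Fin d) → ℂ) (ζ η : Fin n → Fin d)
    (v : EuclideanSpace ℂ (Fin n → Fin d)) (x : Fin n → Fin d) :
    (transfer X u ζ η ▹ v) x = u (X.piecewise x ζ) * v (X.piecewise η x) := by
  rw [Matrix.toLpLin_apply]
  change ∑ y, transfer X u ζ η x y * v y = _
  rw [Finset.sum_eq_single (X.piecewise η x)]
  · rw [transfer, Matrix.of_apply, if_pos]
    exact ⟨fun i hi => by simp [hi], fun i hi => by simp [hi]⟩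
  · intro y _ hy
    rw [transfer, Matrix.of_apply, if_neg, zero_mul]
    rintro ⟨h1, h2⟩
    refine hy (funext fun i => ?_)
    by_cases hi : i ∈ X
    · simp [hi, h2 i hi]
    · simp [hi, h1 i hi]
  · simp

/-- An operator on `X` acts on the coordinates in `X` only: the other coordinates may be frozen. -/
lemma ActsOn.sum_piecewise {X : Finset (Fin n)} {K : Op n d} (hK : ActsOn X K)
    (u : (Fin n → Fin d) → ℂ) (ζ x : Fin n → Fin d) :
    ∑ y, K x y * u (X.piecewise y ζ) = ∑ y, K (X.piecewise x ζ) y * u y := by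
  classical
  have h1 : ∑ y, K x y * u (X.piecewise y ζ) =
      ∑ y with ∀ i, i ∉ X → x i = y i, K x y * u (X.piecewise y ζ) := by
    refine (Finset.sum_filter_of_ne fun y _ hy => ?_).symm
    by_contra h
    push Not at h
    exact hy (by rw [hK.1 x y h, zero_mul])
  have h2 : ∑ y, K (X.piecewise x ζ) y * u y =
      ∑ y with ∀ i, i ∉ X → ζ i = y i, K (X.piecewise x ζ) y * u y := by
    refine (Finset.sum_filter_of_ne fun y _ hy => ?_).symm
    by_contra h
    push Not at h
    obtain ⟨i, hi, hne⟩ := h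
    exact hy (by rw [hK.1 _ y ⟨i, hi, by simpa [hi] using hne⟩, zero_mul])
  rw [h1, h2]
  refine Finset.sum_nbij' (fun y => X.piecewise y ζ) (fun y => X.piecewise y x) ?_ ?_ ?_ ?_ ?_
  · intro y _
    simp +contextual
  · intro y _
    simp +contextual
  · intro y hy
    funext i
    by_cases hi : i ∈ X
    · simp [hi]
    · simp [hi, (Finset.mem_filter.mp hy).2 i hi]
  · intro y hy
    funext i
    by_cases hi : i ∈ X
    · simp [hi]
    · simp [hi, (Finset.mem_filter.mp hy).2 i hi]
  · intro y hy
    have := (Finset.mem_filter.mp hy).2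
    rw [hK.2 x y (X.piecewise x ζ) (X.piecewise y ζ) (fun i hi => by simp [hi])
      (fun i hi => by simp [hi]) this (fun i hi => by simp [hi])]

/-- If `K` acts on `X` and `R` commutes with all the operators on `X`, then `K` and `R` have a common
ground state. -/
lemma exists_common_ground [Nonempty (Fin n → Fin d)] {X : Finset (Fin n)} {K R : Op n d}
    (hK : K.IsHermitian) (hR : R.IsHermitian) (hKX : ActsOn X K)
    (hRX : ∀ T, ActsOn X T → Commute R T) :
    ∃ w : EuclideanSpace ℂ (Fin n → Fin d), w ≠ 0 ∧ K ▹ w = (energy K 0 : ℂ) • w ∧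
      R ▹ w = (energy R 0 : ℂ) • w := by
  obtain ⟨u, hu1, hu⟩ := exists_ground hK
  obtain ⟨v, hv1, hv⟩ := exists_ground hR
  have hne : ∀ w : EuclideanSpace ℂ (Fin n → Fin d), ‖w‖ = 1 → ∃ x, w x ≠ 0 := by
    intro w hw
    by_contra! h
    have : w = 0 := PiLp.ext h
    simp [this] at hw
  obtain ⟨ζ, hζ⟩ := hne u hu1
  obtain ⟨η, hη⟩ := hne v hv1
  refine ⟨transfer X u ζ η ▹ v, fun h0 => ?_, ?_, ?_⟩
  · have := congrArg (fun w : EuclideanSpace ℂ (Fin n → Fin d) => w (X.piecewise ζ η)) h0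
    simp only [transfer_act, PiLp.zero_apply] at this
    have e1 : X.piecewise (X.piecewise ζ η) ζ = ζ := by
      funext i; by_cases hi : i ∈ X <;> simp [hi]
    have e2 : X.piecewise η (X.piecewise ζ η) = η := by
      funext i; by_cases hi : i ∈ X <;> simp [hi]
    rw [e1, e2] at this
    exact mul_ne_zero hζ hη this
  · ext x
    have h1 := congrArg (fun w : EuclideanSpace ℂ (Fin n → Fin d) => w (X.piecewise x ζ)) hu
    rw [Matrix.toLpLin_apply] at h1
    change ∑ y, K (X.piecewise x ζ) y * u y = (energy K 0 : ℂ) * u (X.piecewise x ζ) at h1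
    rw [Matrix.toLpLin_apply]
    change ∑ y, K x y * (transfer X u ζ η ▹ v) y
      = (energy K 0 : ℂ) * (transfer X u ζ η ▹ v) x
    simp only [transfer_act]
    rw [← mul_assoc, ← h1, ← hKX.sum_piecewise u ζ x, Finset.sum_mul]
    refine Finset.sum_congr rfl fun y _ => ?_
    by_cases hy : ∀ i, i ∉ X → x i = y i
    · have : X.piecewise η y = X.piecewise η x :=
        X.piecewise_congr (fun _ _ => rfl) fun i hi => (hy i hi).symm
      rw [this, mul_assoc]
    · push Not at hy
      rw [hKX.1 x y hy, zero_mul, zero_mul, zero_mul]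
  · rw [← mul_act, (hRX _ (transfer_actsOn X u ζ η)).eq, mul_act, hv, map_smul]

/-- The spectral gap is at most twice the norm of the terms that act on a given site `i`: all the
levels of the remaining Hamiltonian `H'` are degenerate. -/
lemma spectralGap_le [Nonempty (Fin n → Fin d)] (hd : 2 ≤ d) (i : Fin n) {H' W : Op n d}
    (hH' : H'.IsHermitian) (hH : (H' + W).IsHermitian)
    (hi : ∀ T, ActsOn {i} T → Commute H' T) : spectralGap (H' + W) ≤ 2 * ‖W‖ := by
  have hc : 1 < Fintype.card (Fin n → Fin d) := by
    rw [Fintype.card_fun, Fintype.card_fin, Fintype.card_fin]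
    exact Nat.one_lt_pow i.pos.ne' hd
  obtain ⟨v, hv1, hv⟩ := exists_ground hH'
  obtain ⟨x₀, hx₀⟩ : ∃ x, v x ≠ 0 := by
    by_contra! h
    have : v = 0 := PiLp.ext h
    simp [this] at hv1
  have : Nontrivial (Fin d) := Fin.nontrivial_iff_two_le.mpr hd
  obtain ⟨s, hs⟩ := exists_ne (x₀ i)
  -- a second vector of the same level, obtained by flipping the spin at `i`
  set w := transfer {i} (fun x => if x i = s then 1 else 0) x₀ x₀ ▹ v with hw
  have hH'w : H' ▹ w = (energy H' 0 : ℂ) • w := by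
    rw [hw, ← mul_act, (hi _ (transfer_actsOn _ _ _ _)).eq, mul_act, hv, map_smul]
  have hw0 : w x₀ = 0 := by
    rw [hw, transfer_act]
    simp [hs.symm]
  have hw1 : w ≠ 0 := by
    intro h0
    have := congrArg (fun w : EuclideanSpace ℂ (Fin n → Fin d) => w (Function.update x₀ i s)) h0
    simp only [hw, transfer_act, PiLp.zero_apply] at this
    have e : ({i} : Finset (Fin n)).piecewise x₀ (Function.update x₀ i s) = x₀ := by
      funext j; by_cases hj : j = i <;> simp [hj]
    rw [e] at this
    simp [hx₀] at this
  obtain ⟨i₀, i₁, -, h0, -, hge⟩ := exists_two_lowest hH hc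
  set b := hH.eigenvectorBasis with hb
  -- in the span of `v` and `w` there is a vector orthogonal to the ground state of `H' + W`
  obtain ⟨φ, hφ0, hφ, hort⟩ : ∃ φ : EuclideanSpace ℂ (Fin n → Fin d), φ ≠ 0 ∧
      H' ▹ φ = (energy H' 0 : ℂ) • φ ∧ inner ℂ (b i₀) φ = 0 := by
    by_cases h : inner ℂ (b i₀) w = 0
    · exact ⟨w, hw1, hH'w, h⟩
    · refine ⟨v - (inner ℂ (b i₀) v / inner ℂ (b i₀) w) • w, fun h1 => ?_, ?_, ?_⟩
      · have := congrArg (fun w : EuclideanSpace ℂ (Fin n → Fin d) => w x₀) h1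
        simp [hw0, hx₀] at this
      · rw [map_sub, map_smul, hv, hH'w, smul_sub, smul_comm]
      · rw [inner_sub_right, inner_smul_right, div_mul_cancel₀ _ h, sub_self]
  have hφn : 0 < ‖φ‖ ^ 2 := by have := norm_pos_iff.mpr hφ0; positivity
  have h1 : energy (H' + W) 1 * ‖φ‖ ^ 2 ≤ (inner ℂ φ ((H' + W) ▹ φ)).re := by
    rw [re_inner_act_eq_sum hH, ← b.sum_sq_norm_inner_right, Finset.mul_sum]
    refine Finset.sum_le_sum fun j _ => ?_
    by_cases hj : j = i₀
    · rw [hj, ← hb, hort]; simp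
    · rw [← hb]
      gcongr
      exact hge j hj
  have h2 : energy (H' + W) 1 ≤ energy H' 0 + ‖W‖ := by
    rw [add_act, inner_add_right, Complex.add_re, re_inner_of_eigen hφ] at h1
    have h3 := (abs_le.mp (re_inner_act_le W φ)).2
    refine le_of_mul_le_mul_right ?_ hφn
    linarith
  have h3 : energy H' 0 - ‖W‖ ≤ energy (H' + W) 0 := by
    obtain ⟨ψ, hψ1, hψ⟩ := exists_ground hH
    have h4 := re_inner_of_eigen hψ
    rw [add_act, inner_add_right, Complex.add_re, hψ1] at h4
    have h5 := energy_zero_mul_le hH' ψ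
    have h6 := (abs_le.mp (re_inner_act_le W ψ)).1
    rw [hψ1] at h5 h6
    linarith
  rw [spectralGap]
  linarith

end Transfer

/-! ### Truncated and effective Hamiltonians of the chain -/

section Chain

/-- Comparison with the integral of `x ^ (-α)` bounds the zeta values. -/
lemma sum_range_one_div_rpow_le {α : ℝ} (hα : 1 < α) (N : ℕ) :
    ∑ r ∈ Finset.range N, 1 / ((r + 1 : ℕ) : ℝ) ^ α ≤ α / (α - 1) := by
  have hα1 : 0 < α - 1 := by linarith
  have h1 : α / (α - 1) = 1 + 1 / (α - 1) := by field_simp; ring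
  rcases N with - | N
  · simp only [Finset.range_zero, Finset.sum_empty]; positivity
  rw [Finset.sum_range_succ', h1, add_comm]
  have hanti : AntitoneOn (fun x : ℝ => x ^ (-α)) (Set.Icc 1 (1 + N)) := by
    intro x hx y _ hxy
    exact Real.rpow_le_rpow_of_nonpos (by linarith [hx.1]) hxy (by linarith)
  have h2 := hanti.sum_le_integral
  rw [integral_rpow (Or.inr ⟨by linarith, by
    rw [Set.uIcc_of_le (by linarith [Nat.cast_nonneg (α := ℝ) N])]
    intro h; linarith [h.1]⟩)] at h2
  refine add_le_add (by simp) ?_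
  calc ∑ r ∈ Finset.range N, 1 / ((r + 1 + 1 : ℕ) : ℝ) ^ α
      = ∑ r ∈ Finset.range N, ((1 : ℝ) + ((r + 1 : ℕ) : ℝ)) ^ (-α) := by
        refine Finset.sum_congr rfl fun r _ => ?_
        rw [Real.rpow_neg (by positivity), one_div]
        push_cast
        ring_nf
    _ ≤ _ := h2
    _ ≤ 1 / (α - 1) := by
        have h3 : 0 ≤ (1 + (N : ℝ)) ^ (-α + 1) := by positivity
        rw [Real.one_rpow, ← neg_div_neg_eq]
        rw [show -(-α + 1) = α - 1 by ring]
        gcongr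
        linarith

variable {n d k : ℕ} (Φ : Interaction n d k)

lemma eq_singleton_of_diam_eq_zero {Z : Finset (Fin n)} {i : Fin n} (hi : i ∈ Z)
    (h : diam Z = 0) : Z = {i} := by
  refine Finset.eq_singleton_iff_unique_mem.mpr ⟨hi, fun j hj => ?_⟩
  have h1 : Nat.dist j i ≤ diam Z :=
    (Finset.le_sup (f := fun i' : Fin n => Nat.dist j i') hi).trans
      (Finset.le_sup (f := fun j' : Fin n => Z.sup fun i' : Fin n => Nat.dist j' i') hj)
  rw [h, Nat.le_zero] at h1
  exact Fin.ext (Nat.eq_of_dist_eq_zero h1)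

lemma diam_lt (Z : Finset (Fin n)) (hn : 0 < n) : diam Z < n := by
  refine (Finset.sup_lt_iff hn).mpr fun j _ => (Finset.sup_lt_iff hn).mpr fun j' _ => ?_
  have := j.2
  have := j'.2
  rw [Nat.dist]
  omega

/-- The one-site energy is at most `g = B + α J / (α - 1)`. -/
lemma Interaction.sum_norm_term_le {J α B : ℝ} (hα : 1 < α) (hJ : Φ.PowerLaw J α)
    (hB : Φ.OneSiteBound B) (i : Fin n) :
    ∑ Z : Finset (Fin n) with i ∈ Z, ‖Φ.term Z‖ ≤ siteEnergy J α B := by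
  have hJ0 : 0 ≤ J := by
    have := hJ i 1 le_rfl
    rw [Nat.cast_one, Real.one_rpow, div_one] at this
    exact (Finset.sum_nonneg fun _ _ => norm_nonneg _).trans this
  rw [← Finset.sum_fiberwise_of_maps_to (t := Finset.range (n + 1)) (g := diam)
    (fun Z _ => Finset.mem_range.mpr ((diam_lt Z i.pos).trans (Nat.lt_succ_self n))),
    Finset.sum_range_succ', add_comm, siteEnergy]
  refine add_le_add ?_ ?_
  · calc ∑ Z ∈ (Finset.univ.filter fun Z : Finset (Fin n) => i ∈ Z) with diam Z = 0, ‖Φ.term Z‖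
        ≤ ∑ Z ∈ {({i} : Finset (Fin n))}, ‖Φ.term Z‖ := by
          refine Finset.sum_le_sum_of_subset_of_nonneg (fun Z hZ => ?_) fun _ _ _ => norm_nonneg _
          simp only [Finset.mem_filter, Finset.mem_univ, true_and] at hZ
          exact Finset.mem_singleton.mpr (eq_singleton_of_diam_eq_zero hZ.1 hZ.2)
      _ ≤ B := by rw [Finset.sum_singleton]; exact hB i
  · calc ∑ r ∈ Finset.range n,
          ∑ Z ∈ (Finset.univ.filter fun Z : Finset (Fin n) => i ∈ Z) with diam Z = r + 1, ‖Φ.term Z‖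
        ≤ ∑ r ∈ Finset.range n, J * (1 / ((r + 1 : ℕ) : ℝ) ^ α) := by
          refine Finset.sum_le_sum fun r _ => ?_
          rw [Finset.filter_filter, mul_one_div]
          exact hJ i (r + 1) (by omega)
      _ ≤ J * (α / (α - 1)) := by
          rw [← Finset.mul_sum]
          exact mul_le_mul_of_nonneg_left (sum_range_one_div_rpow_le hα n) hJ0
      _ = α * J / (α - 1) := by ring

lemma Interaction.siteEnergy_nonneg {J α B : ℝ} (hα : 1 < α) (hJ : Φ.PowerLaw J α)
    (hB : Φ.OneSiteBound B) (i : Fin n) : 0 ≤ siteEnergy J α B :=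
  (Finset.sum_nonneg fun _ _ => norm_nonneg _).trans (Φ.sum_norm_term_le hα hJ hB i)

lemma Interaction.norm_sum_term_le {J α B : ℝ} (hα : 1 < α) (hJ : Φ.PowerLaw J α)
    (hB : Φ.OneSiteBound B) (i : Fin n) (T : Finset (Finset (Fin n))) :
    ‖∑ Z ∈ T with i ∈ Z, Φ.term Z‖ ≤ siteEnergy J α B :=
  (norm_sum_le _ _).trans ((Finset.sum_le_sum_of_subset_of_nonneg
    (Finset.filter_subset_filter _ (Finset.subset_univ _)) fun _ _ _ => norm_nonneg _).trans
    (Φ.sum_norm_term_le hα hJ hB i))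

variable (q l a : ℕ)

lemma mem_block {i : Fin n} {s : ℕ} : i ∈ block n q l a s ↔
    if s = 0 then (i : ℕ) < a
    else if s ≤ q then a + (s - 1) * l ≤ (i : ℕ) ∧ (i : ℕ) < a + s * l
    else a + q * l ≤ (i : ℕ) := by
  simp [block]

lemma isInterval_block (s : ℕ) : IsInterval (block n q l a s) := by
  intro i hi j hj m him hmj
  rw [mem_block] at *
  have h1 : (i : ℕ) ≤ m := him
  have h2 : (m : ℕ) ≤ j := hmj
  split_ifs at * <;> omega

lemma disjoint_block_of_lt {s s' : ℕ} (h : s < s') (hs' : s' ≤ q + 1) :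
    Disjoint (block n q l a s) (block n q l a s') := by
  rw [Finset.disjoint_left]
  intro i hi hi'
  rw [mem_block] at hi hi'
  have h0 : s' ≠ 0 := by omega
  have hsq : s ≤ q := by omega
  have hlt : (i : ℕ) < a + s * l := by
    rcases eq_or_ne s 0 with rfl | h1
    · simpa using hi
    · rw [if_neg h1, if_pos hsq] at hi
      exact hi.2
  have hle : a + (s' - 1) * l ≤ (i : ℕ) := by
    rw [if_neg h0] at hi'
    split_ifs at hi' with h2
    · exact hi'.1
    · have : s' - 1 = q := by omega
      rwa [this]
  have : s * l ≤ (s' - 1) * l := Nat.mul_le_mul_right l (by omega)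
  omega

lemma disjoint_block {s s' : ℕ} (h : s ≠ s') (hs : s ≤ q + 1) (hs' : s' ≤ q + 1) :
    Disjoint (block n q l a s) (block n q l a s') := by
  rcases lt_or_gt_of_ne h with h | h
  · exact disjoint_block_of_lt q l a h hs'
  · exact (disjoint_block_of_lt q l a h hs).symm

lemma isHermitian_blockHam (s : ℕ) : (Φ.blockHam q l a s).IsHermitian :=
  isHermitian_sum fun Z _ => Φ.isHermitian Z

lemma isHermitian_cutBlockHam (τ : ℝ) (s : ℕ) : (Φ.cutBlockHam q l a τ s).IsHermitian :=
  isHermitian_cfc _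

lemma isHermitian_bondHam (s : ℕ) : (Φ.bondHam q l a s).IsHermitian :=
  isHermitian_sum fun Z _ => Φ.isHermitian Z

lemma isHermitian_truncHam : (Φ.truncHam q l a).IsHermitian :=
  (isHermitian_sum fun s _ => isHermitian_blockHam Φ q l a s).add
    (isHermitian_sum fun s _ => isHermitian_bondHam Φ q l a s)

lemma isHermitian_effHam (τ : ℝ) : (Φ.effHam q l a τ).IsHermitian :=
  (isHermitian_sum fun s _ => isHermitian_cutBlockHam Φ q l a τ s).add
    (isHermitian_sum fun s _ => isHermitian_bondHam Φ q l a s)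

lemma actsOn_blockHam (s : ℕ) : ActsOn (block n q l a s) (Φ.blockHam q l a s) :=
  ActsOn.sum fun Z hZ => (Φ.supportedOn Z).actsOn.mono (Finset.mem_filter.mp hZ).2.2

lemma actsOn_bondHam (s : ℕ) :
    ActsOn (block n q l a s ∪ block n q l a (s + 1)) (Φ.bondHam q l a s) := by
  unfold Interaction.bondHam Interaction.V
  exact ActsOn.sum fun Z hZ => (Φ.supportedOn Z).actsOn.mono (Finset.mem_filter.mp hZ).2.1

lemma bondHam_mem_fewBody (s : ℕ) : Φ.bondHam q l a s ∈ fewBody n d k := by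
  unfold Interaction.bondHam Interaction.V
  refine Submodule.sum_mem _ fun Z _ => ?_
  by_cases hZ : Z.card ≤ k
  · exact Submodule.subset_span ⟨Z, hZ, (Φ.supportedOn Z).actsOn.localOn⟩
  · rw [Φ.eq_zero_of_card Z (by omega)]
    exact Submodule.zero_mem _

lemma one_le_siteDist {X Y : Finset (Fin n)} (hX : X.Nonempty) (hY : Y.Nonempty)
    (hXY : Disjoint X Y) : 1 ≤ siteDist X Y := by
  obtain ⟨i, hi⟩ := hX
  obtain ⟨j, hj⟩ := hY
  obtain ⟨i', hi', j', hj', h⟩ := Nat.sInf_mem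
    (s := {r : ℕ | ∃ i ∈ X, ∃ j ∈ Y, r = Nat.dist i j}) ⟨_, i, hi, j, hj, rfl⟩
  by_contra h0
  have h1 : siteDist X Y = 0 := by omega
  rw [siteDist, h] at h1
  have := Fin.ext (Nat.eq_of_dist_eq_zero h1)
  exact Finset.disjoint_left.mp hXY hi' (this ▸ hj')

lemma norm_bondHam_le {g₀ αbar : ℝ} (hg₀ : 0 ≤ g₀) (hαbar : 0 < αbar)
    (hV : Φ.BlockDecay g₀ αbar) {s : ℕ} (hs : s ≤ q) : ‖Φ.bondHam q l a s‖ ≤ g₀ := by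
  set X := block n q l a s with hX
  set Y := block n q l a (s + 1) with hY
  by_cases h : X.Nonempty ∧ Y.Nonempty
  · have hd : Disjoint X Y := disjoint_block q l a (by omega) (by omega) (by omega)
    refine (hV X Y (X ∪ Y) h.1 h.2 (isInterval_block q l a s) (isInterval_block q l a (s + 1)) hd
      subset_rfl).trans ?_
    have h1 : (1 : ℝ) ≤ siteDist X Y := by exact_mod_cast one_le_siteDist h.1 h.2 hd
    have h2 := Real.rpow_le_one_of_one_le_of_nonpos h1 (show -αbar ≤ 0 by linarith)
    exact mul_le_of_le_one_right hg₀ h2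
  · -- an empty edge block has no bond
    have : Φ.bondHam q l a s = 0 := by
      unfold Interaction.bondHam Interaction.V
      refine Finset.sum_eq_zero fun Z hZ => absurd ?_ h
      obtain ⟨-, h1, h2⟩ := (Finset.mem_filter.mp hZ).2
      exact ⟨h1.mono Finset.inter_subset_right, h2.mono Finset.inter_subset_right⟩
    rw [this, norm_zero]
    exact hg₀

/-- The part of the effective Hamiltonian that does not involve the block `B_s`. -/
def restHam (τ : ℝ) (s : ℕ) : Op n d :=
  ∑ s' ∈ (Finset.range (q + 2)).erase s, Φ.cutBlockHam q l a τ s' +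
    ∑ s' ∈ Finset.range (q + 1) with ¬ (s' = s ∨ s' + 1 = s), Φ.bondHam q l a s'

/-- The interaction of the block `B_s` with its neighbours. -/
def nearHam (s : ℕ) : Op n d :=
  ∑ s' ∈ Finset.range (q + 1) with s' = s ∨ s' + 1 = s, Φ.bondHam q l a s'

lemma effHam_eq (τ : ℝ) {s : ℕ} (hs : s ∈ Finset.range (q + 2)) :
    Φ.effHam q l a τ = Φ.cutBlockHam q l a τ s + restHam Φ q l a τ s + nearHam Φ q l a s := by
  rw [Interaction.effHam, restHam, nearHam, ← Finset.add_sum_erase _ _ hs,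
    ← Finset.sum_filter_add_sum_filter_not (Finset.range (q + 1)) (fun s' => s' = s ∨ s' + 1 = s)]
  abel

lemma isHermitian_restHam (τ : ℝ) (s : ℕ) : (restHam Φ q l a τ s).IsHermitian :=
  (isHermitian_sum fun s _ => isHermitian_cutBlockHam Φ q l a τ s).add
    (isHermitian_sum fun s _ => isHermitian_bondHam Φ q l a s)

lemma commute_restHam (τ : ℝ) {s : ℕ} (hs : s ∈ Finset.range (q + 2)) {T : Op n d}
    (hT : ActsOn (block n q l a s) T) : Commute (restHam Φ q l a τ s) T := by
  rw [Finset.mem_range] at hs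
  refine Commute.add_left (Commute.sum_left _ _ _ fun s' hs' => ?_)
    (Commute.sum_left _ _ _ fun s' hs' => ?_)
  · rw [Finset.mem_erase, Finset.mem_range] at hs'
    exact (isHermitian_blockHam Φ q l a s').isSelfAdjoint.commute_cfc
      ((actsOn_blockHam Φ q l a s').commute hT
        (disjoint_block q l a hs'.1 (by omega) (by omega))) _
  · rw [Finset.mem_filter, Finset.mem_range, not_or] at hs'
    refine (actsOn_bondHam Φ q l a s').commute hT (Finset.disjoint_union_left.mpr ⟨?_, ?_⟩)
    · exact disjoint_block q l a hs'.2.1 (by omega) (by omega)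
    · exact disjoint_block q l a hs'.2.2 (by omega) (by omega)

lemma norm_nearHam_le {g₀ αbar : ℝ} (hg₀ : 0 ≤ g₀) (hαbar : 0 < αbar)
    (hV : Φ.BlockDecay g₀ αbar) (s : ℕ) : ‖nearHam Φ q l a s‖ ≤ 2 * g₀ := by
  have hcard : ((Finset.range (q + 1)).filter fun s' => s' = s ∨ s' + 1 = s).card ≤ 2 := by
    refine (Finset.card_le_card (t := {s, s - 1}) fun s' hs' => ?_).trans Finset.card_le_two
    rw [Finset.mem_filter] at hs'
    rw [Finset.mem_insert, Finset.mem_singleton]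
    omega
  calc ‖nearHam Φ q l a s‖
      ≤ ∑ s' ∈ Finset.range (q + 1) with s' = s ∨ s' + 1 = s, g₀ :=
        norm_sum_le_of_le _ fun s' hs' => norm_bondHam_le Φ q l a hg₀ hαbar hV
          (Nat.lt_succ_iff.mp (Finset.mem_range.mp (Finset.mem_filter.mp hs').1))
    _ ≤ 2 * g₀ := by
        rw [Finset.sum_const, nsmul_eq_mul]
        gcongr
        exact_mod_cast hcard

/-- The imaginary time evolution of the boundary interaction of a block under the block
Hamiltonian. -/
lemma norm_exp_conj_nearHam_le {g t : ℝ} (ht : 0 ≤ t) (hg : 0 ≤ g)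
    (hsite : ∀ i : Fin n, ∑ Z : Finset (Fin n) with i ∈ Z, ‖Φ.term Z‖ ≤ g)
    (htg : t * (8 / 3 * g * k ^ 2) ≤ 1 / 2) (s : ℕ) :
    ‖cfc (fun x => Real.exp (t * x)) (Φ.blockHam q l a s) * nearHam Φ q l a s *
      cfc (fun x => Real.exp (-t * x)) (Φ.blockHam q l a s)‖ ≤ 2 * ‖nearHam Φ q l a s‖ := by
  refine norm_exp_conj_le (isHermitian_blockHam Φ q l a s) ht htg (by positivity) (norm_nonneg _)
    fun m => ?_
  set T : Finset (Finset (Fin n)) := (Finset.univ.filter fun Z : Finset (Fin n) =>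
    Z.Nonempty ∧ Z ⊆ block n q l a s).filter fun Z => Z.card ≤ k with hT
  have hsum : Φ.blockHam q l a s = ∑ Z ∈ T, Φ.term Z := by
    refine (Finset.sum_filter_of_ne fun Z _ hZ => ?_).symm
    by_contra h
    exact hZ (Φ.eq_zero_of_card Z (by omega))
  rw [hsum]
  refine norm_iterate_lie_le (fun Z _ => Φ.isHermitian Z) (fun Z _ => (Φ.supportedOn Z).actsOn)
    (fun Z hZ => (Finset.mem_filter.mp hZ).2)
    (fun Z hZ => (Finset.mem_filter.mp (Finset.mem_filter.mp hZ).1).2.1) hg (fun i => ?_)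
    (Submodule.sum_mem _ fun s' _ => bondHam_mem_fewBody Φ q l a s') m
  exact (Finset.sum_le_sum_of_subset_of_nonneg
    (Finset.filter_subset_filter _ (Finset.subset_univ _)) fun _ _ _ => norm_nonneg _).trans
    (hsite i)

/-- A product of ground states of `h_s` and of the rest of the chain bounds the ground state energy
of the effective Hamiltonian from above. -/
lemma energy_effHam_le [Nonempty (Fin n → Fin d)] {τ : ℝ} (hτ : 0 ≤ τ) {s : ℕ}
    (hs : s ∈ Finset.range (q + 2)) :
    energy (Φ.effHam q l a τ) 0 ≤ energy (Φ.blockHam q l a s) 0 + energy (restHam Φ q l a τ s) 0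
      + ‖nearHam Φ q l a s‖ := by
  have hK := isHermitian_blockHam Φ q l a s
  obtain ⟨w, hw0, hKw, hRw⟩ := exists_common_ground hK
    (isHermitian_restHam Φ q l a τ s) (actsOn_blockHam Φ q l a s)
    (fun T hT => commute_restHam Φ q l a τ hs hT)
  have hw : 0 < ‖w‖ ^ 2 := by have := norm_pos_iff.mpr hw0; positivity
  have hcut : Φ.cutBlockHam q l a τ s ▹ w = (energy (Φ.blockHam q l a s) 0 : ℂ) • w := by
    rw [Interaction.cutBlockHam, cutoff, cfc_act_of_eigen hK _ hKw, min_eq_left (by linarith)]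
  have h1 := energy_zero_mul_le (isHermitian_effHam Φ q l a τ) w
  rw [effHam_eq Φ q l a τ hs, add_act, add_act, inner_add_right, inner_add_right, Complex.add_re,
    Complex.add_re, re_inner_of_eigen hcut, re_inner_of_eigen hRw, ← effHam_eq Φ q l a τ hs] at h1
  have h2 := (abs_le.mp (re_inner_act_le (nearHam Φ q l a s) w)).2
  refine le_of_mul_le_mul_right ?_ hw
  linarith

/-- A low-energy eigenvector of the effective Hamiltonian hardly notices the energy cut-off of a
single block. -/
lemma norm_blockHam_sub_cutBlockHam_le [Nonempty (Fin n → Fin d)] {g g₀ t ε τ E z : ℝ}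
    (ht : 0 < t) (hg : 0 ≤ g)
    (hsite : ∀ i : Fin n, ∑ Z : Finset (Fin n) with i ∈ Z, ‖Φ.term Z‖ ≤ g)
    (htg : t * (8 / 3 * g * k ^ 2) ≤ 1 / 2) (hτ : 0 ≤ τ) {s : ℕ} (hs : s ∈ Finset.range (q + 2))
    (hnear : ‖nearHam Φ q l a s‖ ≤ 2 * g₀) {φ : EuclideanSpace ℂ (Fin n → Fin d)} (hφ1 : ‖φ‖ = 1)
    (hφ : Φ.effHam q l a τ ▹ φ = (E : ℂ) • φ) (hE : E ≤ energy (Φ.effHam q l a τ) 0 + ε)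
    (hz : z ≤ τ - 6 * g₀ - ε) (htz : 1 ≤ t * z) :
    ‖Φ.blockHam q l a s ▹ φ - Φ.cutBlockHam q l a τ s ▹ φ‖ ≤ Real.exp (-(t * z)) / t := by
  have hK := isHermitian_blockHam Φ q l a s
  have h1 := energy_effHam_le Φ q l a hτ hs
  have h2 := (norm_exp_conj_nearHam_le Φ q l a ht.le hg hsite htg s).trans
    (show 2 * ‖nearHam Φ q l a s‖ ≤ 4 * g₀ by linarith)
  rw [effHam_eq Φ q l a τ hs] at hφ
  have hzz : z ≤ energy (Φ.blockHam q l a s) 0 + τ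
      - (E - energy (restHam Φ q l a τ s) 0 + 4 * g₀) := by linarith
  have htz' := mul_le_mul_of_nonneg_left hzz ht.le
  refine (norm_sub_cutoff_act_le hK (isHermitian_restHam Φ q l a τ s)
    (commute_restHam Φ q l a τ hs (actsOn_blockHam Φ q l a s)).symm ht h2 hφ hφ1 rfl
    (htz.trans htz')).trans ?_
  gcongr

lemma truncHam_act_sub_effHam_act (τ : ℝ) (φ : EuclideanSpace ℂ (Fin n → Fin d)) :
    Φ.truncHam q l a ▹ φ - Φ.effHam q l a τ ▹ φ
      = ∑ s ∈ Finset.range (q + 2), (Φ.blockHam q l a s ▹ φ - Φ.cutBlockHam q l a τ s ▹ φ) := by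
  rw [Interaction.truncHam, Interaction.effHam, ← sub_act, add_sub_add_right_eq_sub, sub_act,
    sum_act, sum_act, Finset.sum_sub_distrib]

lemma re_inner_effHam_le (τ : ℝ) (φ : EuclideanSpace ℂ (Fin n → Fin d)) :
    (inner ℂ φ (Φ.effHam q l a τ ▹ φ)).re ≤ (inner ℂ φ (Φ.truncHam q l a ▹ φ)).re := by
  rw [← sub_nonneg, ← Complex.sub_re, ← inner_sub_right, truncHam_act_sub_effHam_act, inner_sum,
    Complex.re_sum]
  refine Finset.sum_nonneg fun s _ => ?_
  rw [inner_sub_right, Complex.sub_re, sub_nonneg]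
  exact re_inner_cutoff_le (isHermitian_blockHam Φ q l a s) _ φ

/-- The gap of the truncated Hamiltonian is at most of the order of the one-site energy: a site of
`B_1` takes part in the three operators `h_1`, `h_{0,1}` and `h_{1,2}` only. -/
lemma spectralGap_truncHam_le [Nonempty (Fin n → Fin d)] (hd : 2 ≤ d) (hq : 1 ≤ q) {g : ℝ}
    (hg : 0 ≤ g) {i : Fin n} (hi : i ∈ block n q l a 1)
    (hsite : ∀ T : Finset (Finset (Fin n)), ‖∑ Z ∈ T with i ∈ Z, Φ.term Z‖ ≤ g) :
    spectralGap (Φ.truncHam q l a) ≤ 6 * g := by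
  set S : ℕ → Finset (Finset (Fin n)) := fun s => Finset.univ.filter fun Z : Finset (Fin n) =>
    Z.Nonempty ∧ Z ⊆ block n q l a s with hS
  set S' : ℕ → Finset (Finset (Fin n)) := fun s => Finset.univ.filter fun Z : Finset (Fin n) =>
    Z ⊆ block n q l a s ∪ block n q l a (s + 1) ∧ (Z ∩ block n q l a s).Nonempty ∧
      (Z ∩ block n q l a (s + 1)).Nonempty with hS'
  set W : Op n d := ∑ s ∈ Finset.range (q + 2), ∑ Z ∈ S s with i ∈ Z, Φ.term Z +
    ∑ s ∈ Finset.range (q + 1), ∑ Z ∈ S' s with i ∈ Z, Φ.term Z with hW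
  set H' : Op n d := ∑ s ∈ Finset.range (q + 2), ∑ Z ∈ S s with ¬ i ∈ Z, Φ.term Z +
    ∑ s ∈ Finset.range (q + 1), ∑ Z ∈ S' s with ¬ i ∈ Z, Φ.term Z with hH'
  have hsum : Φ.truncHam q l a = H' + W := by
    have h1 : ∀ s, Φ.blockHam q l a s =
        ∑ Z ∈ S s with i ∈ Z, Φ.term Z + ∑ Z ∈ S s with ¬ i ∈ Z, Φ.term Z :=
      fun s => (Finset.sum_filter_add_sum_filter_not _ _ _).symm
    have h2 : ∀ s, Φ.bondHam q l a s =
        ∑ Z ∈ S' s with i ∈ Z, Φ.term Z + ∑ Z ∈ S' s with ¬ i ∈ Z, Φ.term Z := by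
      intro s
      unfold Interaction.bondHam Interaction.V
      exact (Finset.sum_filter_add_sum_filter_not _ _ _).symm
    rw [Interaction.truncHam, Finset.sum_congr rfl fun s _ => h1 s,
      Finset.sum_congr rfl fun s _ => h2 s, Finset.sum_add_distrib, Finset.sum_add_distrib, hH', hW]
    abel
  have huniq : ∀ s, s ≤ q + 1 → i ∈ block n q l a s → s = 1 := by
    intro s hs his
    by_contra h
    exact Finset.disjoint_left.mp (disjoint_block q l a h hs (by omega)) his hi
  have hP : ∀ s ∈ Finset.range (q + 2), ‖∑ Z ∈ S s with i ∈ Z, Φ.term Z‖ ≤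
      if s = 1 then g else 0 := by
    intro s hs
    rw [Finset.mem_range] at hs
    split_ifs with h
    · exact hsite _
    · rw [Finset.sum_eq_zero, norm_zero]
      intro Z hZ
      simp only [hS, Finset.mem_filter, Finset.mem_univ, true_and] at hZ
      exact absurd (huniq s (by omega) (hZ.1.2 hZ.2)) h
  have hQ : ∀ s ∈ Finset.range (q + 1), ‖∑ Z ∈ S' s with i ∈ Z, Φ.term Z‖ ≤
      (if s = 0 then g else 0) + (if s = 1 then g else 0) := by
    intro s hs
    rw [Finset.mem_range] at hs
    by_cases h : s = 0 ∨ s = 1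
    · refine (hsite _).trans ?_
      rcases h with rfl | rfl <;> simp
    · rw [Finset.sum_eq_zero, norm_zero]
      · positivity
      intro Z hZ
      simp only [hS', Finset.mem_filter, Finset.mem_univ, true_and] at hZ
      exfalso
      rcases Finset.mem_union.mp (hZ.1.1 hZ.2) with h1 | h1
      · exact h (Or.inr (huniq s (by omega) h1))
      · have := huniq (s + 1) (by omega) h1
        omega
  have hWn : ‖W‖ ≤ 3 * g := by
    calc ‖W‖ ≤ ∑ s ∈ Finset.range (q + 2), (if s = 1 then g else 0) +
          ∑ s ∈ Finset.range (q + 1), ((if s = 0 then g else 0) + (if s = 1 then g else 0)) :=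
        (norm_add_le _ _).trans (add_le_add (norm_sum_le_of_le _ hP) (norm_sum_le_of_le _ hQ))
      _ ≤ 3 * g := by
        rw [Finset.sum_add_distrib, Finset.sum_ite_eq', Finset.sum_ite_eq', Finset.sum_ite_eq']
        split_ifs <;> linarith
  have hH'h : H'.IsHermitian :=
    (isHermitian_sum fun s _ => isHermitian_sum fun Z _ => Φ.isHermitian Z).add
      (isHermitian_sum fun s _ => isHermitian_sum fun Z _ => Φ.isHermitian Z)
  have hcomm : ∀ T, ActsOn {i} T → Commute H' T := by
    intro T hT
    have hZ : ∀ Z : Finset (Fin n), i ∉ Z → Commute (Φ.term Z) T := fun Z hZ =>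
      (Φ.supportedOn Z).actsOn.commute hT (Finset.disjoint_singleton_right.mpr hZ)
    exact (Commute.sum_left _ _ _ fun s _ => Commute.sum_left _ _ _ fun Z h =>
      hZ Z (Finset.mem_filter.mp h).2).add_left
      (Commute.sum_left _ _ _ fun s _ => Commute.sum_left _ _ _ fun Z h =>
      hZ Z (Finset.mem_filter.mp h).2)
  have h := spectralGap_le hd i hH'h (hsum ▸ isHermitian_truncHam Φ q l a) hcomm
  rw [hsum]
  linarith

end Chain

end LongRange

end

open LongRange in
theorem theorem5 {n d k q l a : ℕ} (hd : 2 ≤ d) (hq : 2 ≤ q) (hq_even : Even q) (hl : 1 ≤ l)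
    (hn : a + q * l ≤ n) (Φ : Interaction n d k)
    {J α B : ℝ} (hα : 1 < α) (hJ : Φ.PowerLaw J α) (hB : Φ.OneSiteBound B)
    {g₀ αbar : ℝ} (hαbar : 0 < αbar) (hg₀ : siteEnergy J α B ≤ g₀) (hV : Φ.BlockDecay g₀ αbar)
    {g lam lam' Δt : ℝ} (hg : g = siteEnergy J α B)
    (hlam : lam = rate g g₀ k) (hlam' : lam' = rate' g g₀ k)
    (hΔt : Δt = spectralGap (Φ.truncHam q l a)) (hΔt_pos : 0 < Δt)
    {τ : ℝ}
    (hτ : max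
        (8 * g₀ + 1 / lam' * Real.log (88 * g₀ * ((q : ℝ) + 1) * ((q : ℝ) + 2) / Δt))
        (4 * g₀ + 1 / lam * Real.log (432 * ((q : ℝ) + 2) / (lam * Δt))) ≤ τ) :
    Δt / 2 ≤ spectralGap (Φ.effHam q l a τ) ∧
    ∀ ψ φ : EuclideanSpace ℂ (Fin n → Fin d),
      IsGroundState (Φ.truncHam q l a) ψ → IsGroundState (Φ.effHam q l a τ) φ →
      0 ≤ (inner ℂ ψ φ).re → (inner ℂ ψ φ).im = 0 →
      ‖φ - ψ‖ ≤ 54 * ((q : ℝ) + 2) / (lam * Δt) * Real.exp (-lam * (τ - 4 * g₀)) := by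
  have hn0 : a < n := by nlinarith
  have : Nonempty (Fin d) := ⟨⟨0, by omega⟩⟩
  have hc : 1 < Fintype.card (Fin n → Fin d) := by
    rw [Fintype.card_fun, Fintype.card_fin, Fintype.card_fin]
    exact Nat.one_lt_pow (by omega) hd
  have hi : (⟨a, hn0⟩ : Fin n) ∈ block n q l a 1 := by
    rw [mem_block]
    simp only [one_ne_zero, if_false]
    rw [if_pos (by omega)]
    exact ⟨by simp, by simp; omega⟩
  have hsite := Φ.sum_norm_term_le hα hJ hB
  simp only [← hg] at hsite
  have hg0 : 0 ≤ g := hg ▸ Φ.siteEnergy_nonneg hα hJ hB ⟨a, hn0⟩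
  have hgap : Δt ≤ 6 * g := by
    rw [hΔt]
    exact spectralGap_truncHam_le Φ q l a hd (by omega) hg0 hi
      fun T => hg ▸ Φ.norm_sum_term_le hα hJ hB _ T
  rw [← hg] at hg₀
  have hg₀0 : 0 < g₀ := by linarith
  have hden : 0 < 12 * g * (k : ℝ) ^ 2 + 4 * g₀ := by positivity
  have hlam0 : 0 < lam := by rw [hlam, rate]; positivity
  have hlamden : lam * (12 * g * (k : ℝ) ^ 2) + lam * (4 * g₀) = 1 := by
    rw [← mul_add, hlam, rate, one_div_mul_cancel hden.ne']
  have hgk : 0 ≤ lam * (12 * g * (k : ℝ) ^ 2) := by positivity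
  have hlamg₀ : lam * g₀ ≤ 1 / 4 := by linarith
  have htg : lam * (8 / 3 * g * (k : ℝ) ^ 2) ≤ 1 / 2 := by
    have : 0 ≤ lam * g₀ := by positivity
    linarith
  have hlamΔ : lam * Δt ≤ 3 / 2 := by
    calc lam * Δt ≤ lam * (6 * g₀) := by gcongr; linarith
      _ ≤ 3 / 2 := by linarith
  set x := lam * (τ - 4 * g₀) with hx
  -- `L` is the argument of the logarithm in the lower bound on `τ`
  set L := 432 * ((q : ℝ) + 2) / (lam * Δt) with hL
  have hLpos : 0 < L := by positivity
  have hLx : Real.log L ≤ x := by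
    have h1 := (le_max_right _ _).trans hτ
    have h2 : 1 / lam * Real.log L ≤ τ - 4 * g₀ := by linarith
    calc Real.log L = lam * (1 / lam * Real.log L) := by field_simp
      _ ≤ x := by rw [hx]; gcongr
  have hexpL : Real.exp (-x) ≤ 1 / L := by
    rw [Real.exp_neg, ← one_div]
    exact one_div_le_one_div_of_le hLpos ((Real.log_le_iff_le_exp hLpos).mp hLx)
  have hq0 : (0 : ℝ) ≤ q := Nat.cast_nonneg q
  -- `L ≥ 432 * 2 / (3 / 2)` is more than `27 ≥ exp 3`
  have hx3 : 3 ≤ x := by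
    refine le_trans ?_ hLx
    rw [Real.le_log_iff_exp_le hLpos, hL, le_div_iff₀ (by positivity)]
    have h1 : Real.exp 3 ≤ 27 := by
      have h2 : Real.exp 3 = Real.exp 1 ^ 3 := by rw [← Real.exp_nat_mul]; norm_num
      rw [h2]
      calc Real.exp 1 ^ 3 ≤ 3 ^ 3 := by
            gcongr
            linarith [Real.exp_one_lt_d9]
        _ = 27 := by norm_num
    nlinarith [mul_pos hlam0 hΔt_pos, Real.exp_pos 3]
  have hτ0 : 0 ≤ τ := by
    have : 0 < τ - 4 * g₀ := pos_of_mul_pos_right (by linarith) hlam0.le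
    linarith
  -- the energy window `ε = Δt / 2 ≤ 3 g₀` costs the factor `exp (5 / 4) ≤ 4`
  set z := τ - 6 * g₀ - Δt / 2 with hz
  have hzx : x - 5 / 4 ≤ lam * z := by
    have : lam * z = x - 2 * (lam * g₀) - lam * Δt / 2 := by rw [hz, hx]; ring
    linarith
  set η := ((q : ℝ) + 2) * (4 * Real.exp (-x) / lam) with hη
  have hexp : Real.exp (-(lam * z)) ≤ 4 * Real.exp (-x) := by
    calc Real.exp (-(lam * z)) ≤ Real.exp (5 / 4 + -x) := by
          apply Real.exp_le_exp.mpr; linarith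
      _ = Real.exp (5 / 4) * Real.exp (-x) := Real.exp_add _ _
      _ ≤ 4 * Real.exp (-x) := by
          gcongr
          have h2 : Real.exp (5 / 4) ^ 4 = Real.exp 1 ^ 5 := by
            rw [← Real.exp_nat_mul, ← Real.exp_nat_mul]; norm_num
          refine le_of_pow_le_pow_left₀ (n := 4) (by norm_num) (by norm_num) ?_
          rw [h2]
          calc Real.exp 1 ^ 5 ≤ 3 ^ 5 := by
                gcongr
                linarith [Real.exp_one_lt_d9]
            _ ≤ 4 ^ 4 := by norm_num
  have hηΔ : η ≤ spectralGap (Φ.truncHam q l a) / 4 := by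
    rw [← hΔt]
    calc η ≤ ((q : ℝ) + 2) * (4 * (1 / L) / lam) := by rw [hη]; gcongr
      _ = Δt / 108 := by rw [hL]; field_simp; norm_num
      _ ≤ Δt / 4 := by linarith
  obtain ⟨h1, h2⟩ := gap_and_ground_state_of_low_energy (isHermitian_truncHam Φ q l a)
    (isHermitian_effHam Φ q l a τ) hc (hΔt ▸ hΔt_pos) (re_inner_effHam_le Φ q l a τ) hηΔ
    (by
      intro φ E hφ1 hφ hE
      rw [← hΔt] at hE
      rw [truncHam_act_sub_effHam_act]
      calc _ ≤ ∑ s ∈ Finset.range (q + 2), 4 * Real.exp (-x) / lam := by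
            refine norm_sum_le_of_le _ fun s hs => ?_
            refine (norm_blockHam_sub_cutBlockHam_le Φ q l a hlam0 hg0 hsite htg hτ0 hs
              (norm_nearHam_le Φ q l a hg₀0.le hαbar hV s) hφ1 hφ hE le_rfl
              (by linarith)).trans ?_
            gcongr
        _ = η := by simp [hη])
  rw [← hΔt] at h1 h2
  refine ⟨h1, fun ψ φ hψ hφ hre him => (h2 ψ φ hψ hφ hre him).trans ?_⟩
  rw [show -lam * (τ - 4 * g₀) = -x by rw [hx]; ring]
  calc 2 * (η / Δt) = 8 * ((q : ℝ) + 2) / (lam * Δt) * Real.exp (-x) := by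
        rw [hη]; field_simp; norm_num
    _ ≤ _ := by gcongr; norm_num
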